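/- Let $0\le t<1$ and $T>0$. For real $N>0$ put $V(z)=|z|^2-t\,\mathrm{Re}(z^2)$ and let $p_j$ ($j=0,1,2,\dots$) be polynomials of degree exactly $j$ (depending on $N$) with $\int_{\mathbb C}p_j(z)\overline{p_k(z)}e^{-NV(z)}\,dA(z)=\delta_{jk}$, where $dA$ is the area measure; such polynomials exist for every $N>0$, and what follows holds for any choice of them. Put $$K_n(z,w)=\sum_{j=0}^{n-1}p_j(z)\overline{p_j(w)}\,e^{-NV(z)/2}e^{-NV(w)/2}$$ and let $$K=\Big\{z\in\mathbb C:\ \tfrac{1-t}{1+t}(\mathrm{Re}\,z)^2+\tfrac{1+t}{1-t}(\mathrm{Im}\,z)^2\le T\Big\}.$$ Let $V_K$ be a compact subset of $\mathrm{Int}\,K$ and $U_K$ a neighborhood of $K$. Then there exist $\epsilon>0$ and $\delta>0$ such that, as the positive integer $n=NT$ grows to infinity with $T$ fixed, $$\frac1N K_n(z,w)=\begin{cases}\dfrac1\pi\, e^{-\frac N2|z-w|^2}\,e^{iN\,\mathrm{Im}\left(z\overline w-\frac t2z^2-\frac t2\overline w^2\right)}\big(1+\mathcal O(e^{-N\epsilon})\big),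 & w\in V_K,\ |z-w|<\delta,\\[2mm] \mathcal O(e^{-N\epsilon}), & w\in V_K,\ |z-w|\ge\delta,\\[1mm] \mathcal O(e^{-N\epsilon}), & w\notin U_K,\ z\in\mathbb C,\end{cases}$$ uniformly over all $z$ and $w$ as specified: the constants implied by $\mathcal O$, and the threshold on $N$ beyond which the bounds hold, depend only on $t,T,V_K,U_K$ (and the chosen $\epsilon,\delta$). The same formulas for $\frac1NK_n(z,w)$ hold, with the same uniformity, when $z$ and $w$ are exchanged in the conditions on the right. -/

import Mathlib

open MeasureTheory Topology
open scoped ComplexConjugate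

namespace NormalMatrix

/-- The quadratic potential `V(z) = |z|² - t Re(z²)`. -/
noncomputable def potential (t : ℝ) (z : ℂ) : ℝ :=
  ‖z‖ ^ 2 - t * (z ^ 2).re

/-- The elliptic droplet `K`. -/
def droplet (t T : ℝ) : Set ℂ :=
  {z : ℂ | (1 - t) / (1 + t) * z.re ^ 2 + (1 + t) / (1 - t) * z.im ^ 2 ≤ T}

/-- `p` is a system of orthonormal polynomials for the weight `exp(-N V)` with respect to the
area measure on `ℂ`: `p j` has degree exactly `j`, and
`∫ p j(z) conj(p k(z)) exp(-N V(z)) dA(z) = δ_{jk}`.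
(These conditions fix each `p j` up to a unimodular constant, which does not affect the
kernel.) -/
structure IsOrthonormalPolynomials (t N : ℝ) (p : ℕ → Polynomial ℂ) : Prop where
  degree_eq : ∀ j : ℕ, (p j).degree = (j : WithBot ℕ)
  integrable : ∀ j k : ℕ, Integrable
    (fun z : ℂ => (p j).eval z * conj ((p k).eval z) *
      ((Real.exp (-(N * potential t z)) : ℝ) : ℂ)) volume
  orthonormal : ∀ j k : ℕ,
    ∫ z : ℂ, (p j).eval z * conj ((p k).eval z) *
      ((Real.exp (-(N * potential t z)) : ℝ) : ℂ) = if j = k then 1 else 0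

/-- The kernel `K_n(z,w) = ∑_{j<n} p_j(z) conj(p_j(w)) exp(-N V(z)/2) exp(-N V(w)/2)`. -/
noncomputable def corrKernel (t N : ℝ) (p : ℕ → Polynomial ℂ) (n : ℕ) (z w : ℂ) : ℂ :=
  ∑ j ∈ Finset.range n, (p j).eval z * conj ((p j).eval w) *
    ((Real.exp (-(N * potential t z) / 2) : ℝ) : ℂ) *
    ((Real.exp (-(N * potential t w) / 2) : ℝ) : ℂ)

end NormalMatrix

/-! The orthonormal polynomials are explicit. Integration by parts against `exp(-N V)`
(`weightedInner_X_mul`) makes differentiation adjoint to `q ↦ N(1-t²) X q - t q'`, so iterating this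
raising operator on `1` produces rescaled Hermite polynomials that are orthogonal with computable
norms. Orthonormal systems differ only by unimodular constants, which cancel in the kernel, so one
system suffices.

Mehler's formula (`hasSum_mehler`) then sums the series of products of wave functions with an extra
weight `r ^ j`. At `r = 1` the full sum is exactly the main term `bulkKernel`, and on the diagonal
it equals `1/π`. On the diagonal with general `r` the sum is a constant times `exp(N (r-1) E_r(z))`,
where `E_r` is `ellipseForm t r` and the droplet is `E_1 ≤ T`.

A Chernoff bound finishes the proof. If `r ^ n ≤ r ^ j` on an index set, the diagonal sum over that
set is at most a constant times `exp(N ((r-1) E_r(z) - T log r))`. This exponent vanishes at `r = 1`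
and has derivative `E_1(z) - T` there. Inside the droplet some `r > 1` makes the tail `j ≥ n`
exponentially small; outside, some `r < 1` does so for the head `j < n`. Cauchy–Schwarz passes to
off-diagonal sums, with smallness needed at only one of the two points. In the bulk the error is the
tail, compared with the Gaussian size of the main term to choose `δ`. -/

namespace NormalMatrix

/-! ### Hermite-type sequences and their generating function -/

/-- The sequence with `h₀ = 1`, `h₁ = a` and `h_{j+2} = a h_{j+1} + b (j+1) h_j`, whose
exponential generating function is `exp (a s + b s² / 2)`. -/
def hermiteSeq {R : Type*} [CommRing R] (a b : R) : ℕ → R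
  | 0 => 1
  | 1 => a
  | (j + 2) => a * hermiteSeq a b (j + 1) + b * ((j : R) + 1) * hermiteSeq a b j

section HermiteSeq

variable {R S : Type*} [CommRing R] [CommRing S]

@[simp] theorem hermiteSeq_zero (a b : R) : hermiteSeq a b 0 = 1 := rfl

@[simp] theorem hermiteSeq_one (a b : R) : hermiteSeq a b 1 = a := rfl

theorem hermiteSeq_add_two (a b : R) (j : ℕ) : hermiteSeq a b (j + 2) =
    a * hermiteSeq a b (j + 1) + b * ((j : R) + 1) * hermiteSeq a b j := rfl

theorem map_hermiteSeq (f : R →+* S) (a b : R) (j : ℕ) :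
    f (hermiteSeq a b j) = hermiteSeq (f a) (f b) j := by
  induction j using Nat.twoStepInduction with
  | zero => simp
  | one => simp
  | more j h0 h1 => simp [hermiteSeq_add_two, h0, h1]

theorem hermiteSeq_norm_nonneg (x y : ℂ) (j : ℕ) : 0 ≤ hermiteSeq ‖x‖ ‖y‖ j := by
  induction j using Nat.twoStepInduction with
  | zero => simp
  | one => simp
  | more j h0 h1 => rw [hermiteSeq_add_two]; positivity

/-- Supplies the majorant for exchanging sum and integral: the sequence of norms again has a
quadratic exponential as generating function. -/
theorem norm_hermiteSeq_le (x y : ℂ) (j : ℕ) :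
    ‖hermiteSeq x y j‖ ≤ hermiteSeq ‖x‖ ‖y‖ j := by
  induction j using Nat.twoStepInduction with
  | zero => simp
  | one => simp
  | more j h0 h1 =>
    rw [hermiteSeq_add_two, hermiteSeq_add_two]
    refine (norm_add_le _ _).trans ?_
    rw [norm_mul, norm_mul, norm_mul]
    have : ‖(j : ℂ) + 1‖ = (j : ℝ) + 1 := by
      have h := Complex.norm_natCast (j + 1)
      push_cast at h
      exact h
    rw [this]
    gcongr

end HermiteSeq

/-- The function satisfies `f' = (a + b s) f`; differentiating this identity repeatedly gives the
recurrence, which at `s = 0` is that of `hermiteSeq`. -/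
theorem iteratedDeriv_cexp_quadratic (a b : ℂ) (j : ℕ) :
    (∀ s, HasDerivAt (iteratedDeriv j fun s : ℂ => Complex.exp (a * s + b * s ^ 2 / 2))
      (iteratedDeriv (j + 1) (fun s : ℂ => Complex.exp (a * s + b * s ^ 2 / 2)) s) s) ∧
    ∀ s, iteratedDeriv (j + 1) (fun s : ℂ => Complex.exp (a * s + b * s ^ 2 / 2)) s =
      (a + b * s) * iteratedDeriv j (fun s : ℂ => Complex.exp (a * s + b * s ^ 2 / 2)) s +
      b * j * iteratedDeriv (j - 1) (fun s : ℂ => Complex.exp (a * s + b * s ^ 2 / 2)) s := by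
  set f : ℂ → ℂ := fun s => Complex.exp (a * s + b * s ^ 2 / 2) with hf
  have hcd : ContDiff ℂ ⊤ f := by fun_prop
  have hd : ∀ j s, HasDerivAt (iteratedDeriv j f) (iteratedDeriv (j + 1) f s) s := by
    intro j s
    rw [iteratedDeriv_succ]
    have := hcd.differentiable_iteratedDeriv j (WithTop.coe_lt_top _)
    exact (this s).hasDerivAt
  refine ⟨hd j, ?_⟩
  induction j with
  | zero =>
    intro s
    rw [iteratedDeriv_one, iteratedDeriv_zero]
    have h2 : HasDerivAt f (Complex.exp (a * s + b * s ^ 2 / 2) *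
        (a * 1 + b * (((2 : ℕ) : ℂ) * s ^ (2 - 1)) / 2)) s :=
      (((hasDerivAt_id s).const_mul a).add (((hasDerivAt_pow 2 s).const_mul b).div_const 2)).cexp
    rw [h2.deriv]
    simp only [hf]
    push_cast
    ring
  | succ j ih =>
    intro s
    have h2 : HasDerivAt (iteratedDeriv (j + 1) f)
        ((b * 1) * iteratedDeriv j f s + (a + b * s) * iteratedDeriv (j + 1) f s +
          b * j * iteratedDeriv (j - 1 + 1) f s) s := by
      have h3 := ((((hasDerivAt_id s).const_mul b).const_add a).mul (hd j s)).add
        ((hd (j - 1) s).const_mul (b * j))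
      exact h3.congr_of_eventuallyEq (Filter.Eventually.of_forall ih)
    rw [(hd (j + 1) s).unique h2]
    rcases j with _ | j
    · simp; ring
    · simp; ring

theorem iteratedDeriv_cexp_quadratic_zero (a b : ℂ) (j : ℕ) :
    iteratedDeriv j (fun s : ℂ => Complex.exp (a * s + b * s ^ 2 / 2)) 0 =
      hermiteSeq a b j := by
  induction j using Nat.twoStepInduction with
  | zero => simp
  | one => rw [(iteratedDeriv_cexp_quadratic a b 0).2]; simp
  | more j h0 h1 =>
    rw [(iteratedDeriv_cexp_quadratic a b (j + 1)).2, hermiteSeq_add_two, ← h0, ← h1]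
    simp

/-- The exponential generating function of `hermiteSeq`. -/
theorem hasSum_hermiteSeq (a b s : ℂ) :
    HasSum (fun j : ℕ => hermiteSeq a b j * s ^ j / (j.factorial : ℂ))
      (Complex.exp (a * s + b * s ^ 2 / 2)) := by
  have h := Complex.hasSum_taylorSeries_of_entire
    (f := fun s : ℂ => Complex.exp (a * s + b * s ^ 2 / 2)) (by fun_prop) 0 s
  refine h.congr_fun fun j => ?_
  rw [iteratedDeriv_cexp_quadratic_zero]
  simp only [smul_eq_mul, sub_zero]
  field_simp

theorem hasSum_hermiteSeq_real (a b s : ℝ) :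
    HasSum (fun j : ℕ => hermiteSeq a b j * s ^ j / (j.factorial : ℝ))
      (Real.exp (a * s + b * s ^ 2 / 2)) := by
  rw [← Complex.hasSum_ofReal]
  have h := hasSum_hermiteSeq a b s
  push_cast
  convert h using 3 with j
  exact congrArg (· * (s : ℂ) ^ j) (map_hermiteSeq Complex.ofRealHom a b j)

/-! ### Gaussian integrability and moments -/

theorem exists_norm_eval_le_exp_sq (p : Polynomial ℂ) {ε : ℝ} (hε : 0 < ε) :
    ∃ C : ℝ, 0 ≤ C ∧ ∀ z : ℂ, ‖p.eval z‖ ≤ C * Real.exp (ε * ‖z‖ ^ 2) := by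
  induction p using Polynomial.induction_on' with
  | add p q hp hq =>
    obtain ⟨C, hC, h⟩ := hp
    obtain ⟨D, hD, h'⟩ := hq
    refine ⟨C + D, by positivity, fun z => ?_⟩
    rw [Polynomial.eval_add, add_mul]
    exact (norm_add_le _ _).trans (add_le_add (h z) (h' z))
  | monomial n a =>
    refine ⟨‖a‖ * (1 + n.factorial / ε ^ n), by positivity, fun z => ?_⟩
    rw [Polynomial.eval_monomial, norm_mul, norm_pow, mul_assoc]
    gcongr
    have h1 : (1 : ℝ) ≤ Real.exp (ε * ‖z‖ ^ 2) := Real.one_le_exp (by positivity)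
    have h2 : ‖z‖ ^ n ≤ 1 + (‖z‖ ^ n) ^ 2 := by nlinarith [sq_nonneg (‖z‖ ^ n - 1)]
    have h3 := Real.pow_div_factorial_le_exp (ε * ‖z‖ ^ 2) (by positivity) n
    have h4 : (‖z‖ ^ n) ^ 2 = n.factorial / ε ^ n * ((ε * ‖z‖ ^ 2) ^ n / n.factorial) := by
      have : (n.factorial : ℝ) ≠ 0 := by positivity
      rw [mul_pow]
      field_simp
      ring
    rw [add_mul, one_mul]
    refine h2.trans (add_le_add h1 ?_)
    rw [h4]
    gcongr

theorem integrable_eval_ofReal_mul_gaussian (p : Polynomial ℂ) :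
    Integrable fun x : ℝ => p.eval (x : ℂ) * Complex.exp (-(x : ℂ) ^ 2 / 2) := by
  obtain ⟨C, hC, h⟩ := exists_norm_eval_le_exp_sq p (ε := 1 / 4) (by norm_num)
  refine Integrable.mono' ((integrable_exp_neg_mul_sq (b := 1 / 4) (by norm_num)).const_mul C)
    ?_ (Filter.Eventually.of_forall fun x => ?_)
  · exact (by fun_prop : Continuous fun x : ℝ =>
      p.eval (x : ℂ) * Complex.exp (-(x : ℂ) ^ 2 / 2)).aestronglyMeasurable
  · rw [norm_mul, Complex.norm_exp]
    have : (-(x : ℂ) ^ 2 / 2).re = - x ^ 2 / 2 := by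
      have : (-(x : ℂ) ^ 2 / 2) = ((- x ^ 2 / 2 : ℝ) : ℂ) := by push_cast; ring
      rw [this, Complex.ofReal_re]
    rw [this]
    have h' := h x
    rw [Complex.norm_real, Real.norm_eq_abs, sq_abs] at h'
    calc _ ≤ C * Real.exp (1 / 4 * x ^ 2) * Real.exp (-x ^ 2 / 2) := by gcongr
      _ = _ := by rw [mul_assoc, ← Real.exp_add]; congr 2; ring

theorem integrable_pow_mul_gaussian (a c : ℂ) (i j : ℕ) :
    Integrable fun x : ℝ => (x : ℂ) ^ i * (a + c * x) ^ j * Complex.exp (-(x : ℂ) ^ 2 / 2) := by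
  convert integrable_eval_ofReal_mul_gaussian
    (Polynomial.X ^ i * (Polynomial.C a + Polynomial.C c * Polynomial.X) ^ j) using 3
  simp

/-- Integration by parts, since `x exp(-x²/2)` is the derivative of `-exp(-x²/2)`. For `j = 0` the
truncated exponent is harmless because of the factor `j`. -/
theorem integral_mul_pow_mul_gaussian (a c : ℂ) (j : ℕ) :
    ∫ x : ℝ, (x : ℂ) * (a + c * x) ^ j * Complex.exp (-(x : ℂ) ^ 2 / 2) =
      c * j * ∫ x : ℝ, (a + c * x) ^ (j - 1) * Complex.exp (-(x : ℂ) ^ 2 / 2) := by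
  have hu : ∀ x : ℝ, HasDerivAt (fun x : ℝ => (a + c * (x : ℂ)) ^ j)
      (j * (a + c * x) ^ (j - 1) * (c * 1)) x := fun x =>
    ((Complex.ofRealCLM.hasDerivAt (x := x)).const_mul c |>.const_add a).pow j
  have hv : ∀ x : ℝ, HasDerivAt (fun x : ℝ => -Complex.exp (-(x : ℂ) ^ 2 / 2))
      ((x : ℂ) * Complex.exp (-(x : ℂ) ^ 2 / 2)) x := fun x => by
    refine ((((Complex.ofRealCLM.hasDerivAt (x := x)).pow 2).neg.div_const 2).cexp.neg).congr_deriv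
      ?_
    simp only [Complex.ofRealCLM_apply, Complex.ofReal_one, Pi.neg_apply, Pi.pow_apply]
    push_cast
    ring
  have h := integral_mul_deriv_eq_deriv_mul_of_integrable
    (fun x _ => hu x) (fun x _ => hv x)
    ((integrable_pow_mul_gaussian a c 1 j).congr (Filter.Eventually.of_forall fun x => by
      simp; ring))
    (((integrable_pow_mul_gaussian a c 0 (j - 1)).const_mul (-(j * c))).congr
      (Filter.Eventually.of_forall fun x => by simp; ring))
    ((integrable_pow_mul_gaussian a c 0 j).neg.congr
      (Filter.Eventually.of_forall fun x => by simp))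
  rw [← integral_const_mul]
  calc _ = _ := integral_congr_ae (Filter.Eventually.of_forall fun x => by ring)
    _ = _ := h
    _ = _ := by
      rw [← integral_neg]
      exact integral_congr_ae (Filter.Eventually.of_forall fun x => by
        ring)

theorem integral_gaussian_half :
    ∫ x : ℝ, Complex.exp (-(x : ℂ) ^ 2 / 2) = (√(2 * Real.pi) : ℂ) := by
  have h := integral_gaussian (1 / 2)
  have h2 : ∀ x : ℝ, Complex.exp (-(x : ℂ) ^ 2 / 2) =
      ((Real.exp (-(1 / 2) * x ^ 2) : ℝ) : ℂ) := fun x => by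
    push_cast
    congr 1
    ring
  simp_rw [h2]
  rw [integral_complex_ofReal, h]
  congr 2
  ring

/-- Moments of a shifted and scaled standard Gaussian variable. -/
theorem integral_pow_mul_gaussian (a c : ℂ) (j : ℕ) :
    ∫ x : ℝ, (a + c * x) ^ j * Complex.exp (-(x : ℂ) ^ 2 / 2) =
      (√(2 * Real.pi) : ℂ) * hermiteSeq a (c ^ 2) j := by
  have hrec : ∀ j : ℕ, ∫ x : ℝ, (a + c * x) ^ (j + 1) * Complex.exp (-(x : ℂ) ^ 2 / 2) =
      a * (∫ x : ℝ, (a + c * x) ^ j * Complex.exp (-(x : ℂ) ^ 2 / 2)) +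
      c ^ 2 * j * ∫ x : ℝ, (a + c * x) ^ (j - 1) * Complex.exp (-(x : ℂ) ^ 2 / 2) := by
    intro j
    have h0 : Integrable fun x : ℝ => (a + c * x) ^ j * Complex.exp (-(x : ℂ) ^ 2 / 2) := by
      simpa using integrable_pow_mul_gaussian a c 0 j
    have h1 : Integrable fun x : ℝ =>
        (x : ℂ) * (a + c * x) ^ j * Complex.exp (-(x : ℂ) ^ 2 / 2) := by
      simpa using integrable_pow_mul_gaussian a c 1 j
    rw [pow_two c, mul_assoc c c, mul_assoc c, ← integral_mul_pow_mul_gaussian, ← integral_const_mul,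
      ← integral_const_mul, ← integral_add (h0.const_mul a) (h1.const_mul c)]
    exact integral_congr_ae (Filter.Eventually.of_forall fun x => by simp only; ring)
  induction j using Nat.twoStepInduction with
  | zero => simp [integral_gaussian_half]
  | one =>
    rw [hrec 0]
    simp [integral_gaussian_half, mul_comm]
  | more j h0 h1 =>
    rw [hrec (j + 1), hermiteSeq_add_two, h1, Nat.add_sub_cancel, h0]
    push_cast
    ring

/-! ### Mehler's formula -/

theorem integrable_exp_abs_add_sq (A B : ℝ) (hB : B < 1 / 2) :
    Integrable fun x : ℝ => Real.exp (A * |x| + B * x ^ 2) * Real.exp (-x ^ 2 / 2) := by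
  -- Half of the available decay: one `b x²` absorbs `A |x|` by completing the square, the other
  -- keeps the Gaussian integrable.
  set b : ℝ := (1 / 2 - B) / 2 with hb
  have hb0 : 0 < b := by rw [hb]; linarith
  refine Integrable.mono' ((integrable_exp_neg_mul_sq hb0).const_mul (Real.exp (A ^ 2 / (4 * b))))
    (by fun_prop) (Filter.Eventually.of_forall fun x => ?_)
  rw [Real.norm_of_nonneg (by positivity), ← Real.exp_add, ← Real.exp_add]
  apply Real.exp_le_exp.2
  have h1 : A * |x| ≤ A ^ 2 / (4 * b) + b * x ^ 2 := by
    rw [← sub_nonneg]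
    have : A ^ 2 / (4 * b) + b * x ^ 2 - A * |x| = b * (|x| - A / (2 * b)) ^ 2 := by
      rw [← sq_abs x]
      field_simp
      ring
    rw [this]
    positivity
  have h2 : B = 1 / 2 - 2 * b := by rw [hb]; ring
  rw [h2]
  linarith

/-- Writing the second factor as a Gaussian moment leaves, under the integral, the generating
function of the first. The smallness hypothesis keeps the quadratic coefficient of the dominating
exponential below `1/2`. -/
theorem hasSum_hermiteSeq_mul (a b a' c ρ : ℂ) (h : ‖b‖ * ‖ρ‖ ^ 2 * ‖c‖ ^ 2 < 1) :
    HasSum (fun j : ℕ => ρ ^ j * hermiteSeq a b j * hermiteSeq a' (c ^ 2) j / (j.factorial : ℂ))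
      ((√(2 * Real.pi) : ℂ)⁻¹ * ∫ x : ℝ, Complex.exp
        (a * (ρ * (a' + c * x)) + b * (ρ * (a' + c * x)) ^ 2 / 2 + -(x : ℂ) ^ 2 / 2)) := by
  set R : ℝ → ℝ := fun x => ‖ρ‖ * (‖a'‖ + ‖c‖ * |x|) with hR
  have hbd := fun x : ℝ => (hasSum_hermiteSeq_real ‖a‖ ‖b‖ (R x)).mul_right (Real.exp (-x ^ 2 / 2))
  have hnorm : ∀ x : ℝ, ‖Complex.exp (-(x : ℂ) ^ 2 / 2)‖ = Real.exp (-x ^ 2 / 2) := fun x => by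
    rw [← Complex.norm_of_nonneg (Real.exp_pos (-x ^ 2 / 2)).le]
    push_cast
    rfl
  have key := hasSum_integral_of_dominated_convergence (μ := (volume : Measure ℝ))
    (F := fun (j : ℕ) (x : ℝ) => hermiteSeq a b j * (ρ * (a' + c * x)) ^ j / (j.factorial : ℂ) *
      Complex.exp (-(x : ℂ) ^ 2 / 2))
    (f := fun x : ℝ => Complex.exp (a * (ρ * (a' + c * x)) + b * (ρ * (a' + c * x)) ^ 2 / 2) *
      Complex.exp (-(x : ℂ) ^ 2 / 2))
    (fun (j : ℕ) (x : ℝ) => hermiteSeq ‖a‖ ‖b‖ j * R x ^ j / (j.factorial : ℝ) *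
      Real.exp (-x ^ 2 / 2))
    (fun j => by
      exact (by fun_prop : Continuous fun x : ℝ => hermiteSeq a b j * (ρ * (a' + c * x)) ^ j /
        (j.factorial : ℂ) * Complex.exp (-(x : ℂ) ^ 2 / 2)).aestronglyMeasurable)
    (fun j => Filter.Eventually.of_forall fun x => by
      rw [norm_mul, norm_div, norm_mul, norm_pow, norm_mul, Complex.norm_natCast, hnorm]
      have h1 : ‖a' + c * x‖ ≤ ‖a'‖ + ‖c‖ * |x| := by
        refine (norm_add_le _ _).trans ?_
        rw [norm_mul, Complex.norm_real, Real.norm_eq_abs]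
      have h2 := norm_hermiteSeq_le a b j
      have h3 := hermiteSeq_norm_nonneg a b j
      simp only [hR]
      gcongr)
    (Filter.Eventually.of_forall fun x => (hbd x).summable)
    (by
      simp_rw [fun x => (hbd x).tsum_eq]
      convert (integrable_exp_abs_add_sq
        (‖a‖ * ‖ρ‖ * ‖c‖ + ‖b‖ * ‖ρ‖ ^ 2 * ‖a'‖ * ‖c‖) (‖b‖ * ‖ρ‖ ^ 2 * ‖c‖ ^ 2 / 2)
        (by linarith)).const_mul
        (Real.exp (‖a‖ * ‖ρ‖ * ‖a'‖ + ‖b‖ * ‖ρ‖ ^ 2 * ‖a'‖ ^ 2 / 2)) using 2 with x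
      simp only [← Real.exp_add]
      apply congrArg Real.exp
      simp only [hR]
      rw [← sq_abs x]
      ring)
    (Filter.Eventually.of_forall fun x => (hasSum_hermiteSeq a b _).mul_right _)
  have hpi : (√(2 * Real.pi) : ℂ) ≠ 0 := by
    have : √(2 * Real.pi) ≠ 0 := by positivity
    exact_mod_cast this
  have key2 := key.mul_left ((√(2 * Real.pi) : ℂ)⁻¹)
  simp_rw [Complex.exp_add _ (-((_ : ℝ) : ℂ) ^ 2 / 2)]
  refine key2.congr_fun fun j => ?_
  have : ∫ x : ℝ, hermiteSeq a b j * (ρ * (a' + c * x)) ^ j / (j.factorial : ℂ) *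
      Complex.exp (-(x : ℂ) ^ 2 / 2) =
      hermiteSeq a b j * ρ ^ j / (j.factorial : ℂ) *
        ∫ x : ℝ, (a' + c * x) ^ j * Complex.exp (-(x : ℂ) ^ 2 / 2) := by
    rw [← integral_const_mul]
    exact integral_congr_ae (Filter.Eventually.of_forall fun x => by
      simp only [mul_pow]; ring)
  rw [this, integral_pow_mul_gaussian]
  field_simp

/-- Mehler's formula for the Hermite-type polynomials `hermiteSeq (κ x) (-t κ) j`. -/
theorem hasSum_mehler {t κ r : ℝ} (ht : 0 ≤ t) (hκ : 0 < κ) (hr : 0 ≤ r) (hrt : t * r < 1)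
    (x y : ℂ) :
    HasSum (fun j : ℕ => ((r / κ : ℝ) : ℂ) ^ j * hermiteSeq (κ * x) (-(t * κ)) j *
        hermiteSeq (κ * y) (-(t * κ)) j / (j.factorial : ℂ))
      (((√(1 - t ^ 2 * r ^ 2))⁻¹ : ℝ) * Complex.exp
        (((κ / (1 - t ^ 2 * r ^ 2) : ℝ) : ℂ) * (r * x * y - t * r ^ 2 * (x ^ 2 + y ^ 2) / 2))) := by
  have hsq : t ^ 2 * r ^ 2 < 1 := by
    have : 0 ≤ t * r := by positivity
    nlinarith
  -- An imaginary scale, so that `c ^ 2` is the negative second parameter `-(t κ)` and the moment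
  -- representation applies; the remaining integral is Gaussian with quadratic coefficient `-(1 - t²
  -- r²)/2`.
  set c : ℂ := Complex.I * (√(t * κ) : ℝ) with hc
  have hc2 : c ^ 2 = -(t * κ) := by
    rw [hc, mul_pow, Complex.I_sq, ← Complex.ofReal_pow, Real.sq_sqrt (by positivity)]
    push_cast
    ring
  have hcn : ‖c‖ ^ 2 = t * κ := by
    rw [← norm_pow, hc2, norm_neg, ← Complex.ofReal_mul, Complex.norm_of_nonneg (by positivity)]
  have hbn : ‖(-(t * κ) : ℂ)‖ = t * κ := by
    rw [norm_neg, ← Complex.ofReal_mul, Complex.norm_of_nonneg (by positivity)]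
  have hρn : ‖((r / κ : ℝ) : ℂ)‖ = r / κ := Complex.norm_of_nonneg (by positivity)
  have h := hasSum_hermiteSeq_mul (κ * x) (-(t * κ)) (κ * y) c ((r / κ : ℝ) : ℂ) (by
    rw [hbn, hcn, hρn]
    have : t * κ * (r / κ) ^ 2 * (t * κ) = t ^ 2 * r ^ 2 := by field_simp
    rwa [this])
  rw [hc2] at h
  convert h using 1
  set q : ℝ := 1 - t ^ 2 * r ^ 2 with hq
  have hq0 : 0 < q := by linarith
  have hκ0 : (κ : ℂ) ≠ 0 := by exact_mod_cast hκ.ne'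
  have hqc : (q : ℂ) ≠ 0 := by exact_mod_cast hq0.ne'
  have hqe : (q : ℂ) = 1 - t ^ 2 * r ^ 2 := by rw [hq]; push_cast; ring
  have hint := integral_cexp_quadratic (b := ((-(q / 2) : ℝ) : ℂ))
    (by rw [Complex.ofReal_re]; linarith) (r * c * (x - t * r * y))
    (κ * (r * x * y - t * r ^ 2 * y ^ 2 / 2))
  have hexp : ∀ u : ℝ, κ * x * (((r / κ : ℝ) : ℂ) * (κ * y + c * u)) +
      -(t * κ) * (((r / κ : ℝ) : ℂ) * (κ * y + c * u)) ^ 2 / 2 + -(u : ℂ) ^ 2 / 2 =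
      ((-(q / 2) : ℝ) : ℂ) * u ^ 2 + (r * c * (x - t * r * y)) * u +
        κ * (r * x * y - t * r ^ 2 * y ^ 2 / 2) := fun u => by
    have e1 : -(t * κ) * (((r / κ : ℝ) : ℂ) * (κ * y + c * u)) ^ 2 =
        -(t / κ) * r ^ 2 * (κ ^ 2 * y ^ 2 + 2 * κ * y * c * u + c ^ 2 * u ^ 2) := by
      push_cast
      field_simp
      ring
    rw [e1, hc2]
    push_cast
    rw [hqe]
    field_simp
    ring
  simp_rw [hexp]
  rw [hint]
  have hfac : (Real.pi / -((-(q / 2) : ℝ) : ℂ)) ^ (1 / 2 : ℂ) =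
      (√(2 * Real.pi) : ℂ) * ((√q)⁻¹ : ℝ) := by
    have e1 : (Real.pi / -((-(q / 2) : ℝ) : ℂ)) = ((2 * Real.pi / q : ℝ) : ℂ) := by
      push_cast
      field_simp
    have e2 : (1 / 2 : ℂ) = ((1 / 2 : ℝ) : ℂ) := by push_cast; rfl
    rw [e1, e2, ← Complex.ofReal_cpow (by positivity), ← Real.sqrt_eq_rpow,
      Real.sqrt_div (by positivity)]
    push_cast
    rfl
  have hpi : (√(2 * Real.pi) : ℂ) ≠ 0 := by
    have : √(2 * Real.pi) ≠ 0 := by positivity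
    exact_mod_cast this
  rw [hfac, mul_assoc (√(2 * Real.pi) : ℂ), inv_mul_cancel_left₀ hpi]
  congr 2
  have e3 : (r * c * (x - t * r * y)) ^ 2 = -(t * κ) * (r ^ 2 * (x - t * r * y) ^ 2) := by
    rw [← hc2]
    ring
  rw [e3]
  push_cast
  field_simp
  rw [hqe]
  ring

/-! ### The weighted inner product and integration by parts -/

theorem potential_eq (t : ℝ) (z : ℂ) :
    potential t z = (1 - t) * z.re ^ 2 + (1 + t) * z.im ^ 2 := by
  rw [potential, Complex.sq_norm, Complex.normSq_apply, pow_two z, Complex.mul_re]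
  ring

theorem le_potential {t : ℝ} (ht : 0 ≤ t) (z : ℂ) : (1 - t) * ‖z‖ ^ 2 ≤ potential t z := by
  rw [potential_eq, Complex.sq_norm, Complex.normSq_apply]
  nlinarith [sq_nonneg z.im]

theorem integrable_eval_mul_conj_eval {t N : ℝ} (ht : 0 ≤ t) (ht1 : t < 1) (hN : 0 < N)
    (q r : Polynomial ℂ) : Integrable (fun z : ℂ => q.eval z * conj (r.eval z) *
      ((Real.exp (-(N * potential t z)) : ℝ) : ℂ)) volume := by
  -- The weight decays at least like `exp(-3ε‖z‖²)`; each polynomial costs one `ε`, leaving one for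
  -- integrability.
  set ε : ℝ := N * (1 - t) / 3 with hε
  have hε0 : 0 < ε := by
    have : 0 < 1 - t := by linarith
    rw [hε]; positivity
  obtain ⟨C, hC, hq⟩ := exists_norm_eval_le_exp_sq q hε0
  obtain ⟨D, hD, hr⟩ := exists_norm_eval_le_exp_sq r hε0
  have hint : Integrable (fun z : ℂ => C * D * Real.exp (-ε * ‖z‖ ^ 2)) volume := by
    have h := GaussianFourier.integrable_cexp_neg_mul_sq_norm_add (V := ℂ) (b := (ε : ℂ))
      (by simpa using hε0) 0 0
    refine (h.norm.congr (Filter.Eventually.of_forall fun z => ?_)).const_mul (C * D)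
    simp only [zero_mul, add_zero]
    rw [← Complex.norm_of_nonneg (Real.exp_pos (-ε * ‖z‖ ^ 2)).le]
    push_cast
    rfl
  refine hint.mono' ?_ (Filter.Eventually.of_forall fun z => ?_)
  · have : Continuous fun z : ℂ => q.eval z * conj (r.eval z) *
        ((Real.exp (-(N * potential t z)) : ℝ) : ℂ) := by
      have h1 : Continuous fun z : ℂ => conj (r.eval z) := Complex.continuous_conj.comp r.continuous
      simp_rw [potential_eq]
      fun_prop
    exact this.aestronglyMeasurable
  · rw [norm_mul, norm_mul, RCLike.norm_conj, Complex.norm_of_nonneg (Real.exp_pos _).le]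
    calc _ ≤ (C * Real.exp (ε * ‖z‖ ^ 2)) * (D * Real.exp (ε * ‖z‖ ^ 2)) *
          Real.exp (-(N * ((1 - t) * ‖z‖ ^ 2))) := by
          gcongr
          · exact hq z
          · exact hr z
          · exact le_potential ht z
      _ = C * D * (Real.exp (ε * ‖z‖ ^ 2) * Real.exp (ε * ‖z‖ ^ 2) *
          Real.exp (-(N * ((1 - t) * ‖z‖ ^ 2)))) := by ring
      _ = _ := by
        rw [← Real.exp_add, ← Real.exp_add]
        congr 2
        rw [hε]
        ring

/-- The inner product of polynomials in `L²(exp(-N V) dA)`. -/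
noncomputable def weightedInner (t N : ℝ) (q r : Polynomial ℂ) : ℂ :=
  ∫ z : ℂ, q.eval z * conj (r.eval z) * ((Real.exp (-(N * potential t z)) : ℝ) : ℂ)

section WeightedInner

variable {t N : ℝ} (ht : 0 ≤ t) (ht1 : t < 1) (hN : 0 < N)
include ht ht1 hN

theorem weightedInner_add_left (q q' r : Polynomial ℂ) :
    weightedInner t N (q + q') r = weightedInner t N q r + weightedInner t N q' r := by
  unfold weightedInner
  rw [← integral_add (integrable_eval_mul_conj_eval ht ht1 hN q r)
    (integrable_eval_mul_conj_eval ht ht1 hN q' r)]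
  exact integral_congr_ae (Filter.Eventually.of_forall fun z => by
    simp only [Polynomial.eval_add]; ring)

omit ht ht1 hN in
theorem weightedInner_C_mul_left (c : ℂ) (q r : Polynomial ℂ) :
    weightedInner t N (Polynomial.C c * q) r = c * weightedInner t N q r := by
  unfold weightedInner
  rw [← integral_const_mul]
  exact integral_congr_ae (Filter.Eventually.of_forall fun z => by
    simp only [Polynomial.eval_mul, Polynomial.eval_C]; ring)

omit ht ht1 hN in
theorem conj_weightedInner (q r : Polynomial ℂ) :
    conj (weightedInner t N q r) = weightedInner t N r q := by
  unfold weightedInner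
  rw [← integral_conj]
  exact integral_congr_ae (Filter.Eventually.of_forall fun z => by
    simp only [map_mul, Complex.conj_conj, Complex.conj_ofReal]; ring)

omit ht ht1 hN in
theorem weightedInner_C_mul_right (c : ℂ) (q r : Polynomial ℂ) :
    weightedInner t N q (Polynomial.C c * r) = conj c * weightedInner t N q r := by
  rw [← conj_weightedInner, weightedInner_C_mul_left, map_mul, conj_weightedInner]

omit ht ht1 hN in
theorem hasLineDerivAt_weight (z v : ℂ) :
    HasLineDerivAt ℝ (fun z : ℂ => ((Real.exp (-(N * potential t z)) : ℝ) : ℂ))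
      (-(2 * N * ((1 - t) * z.re * v.re + (1 + t) * z.im * v.im)) *
        ((Real.exp (-(N * potential t z)) : ℝ) : ℂ)) z v := by
  unfold HasLineDerivAt
  have hid := hasDerivAt_id (0 : ℝ)
  have h1 := (((hid.mul_const v.re).const_add z.re).pow 2).const_mul (1 - t)
  have h2 := (((hid.mul_const v.im).const_add z.im).pow 2).const_mul (1 + t)
  have h3 := ((h1.add h2).const_mul N).neg.exp.ofReal_comp
  have h4 : HasDerivAt (fun s : ℝ => ((Real.exp (-(N * potential t (z + s • v))) : ℝ) : ℂ)) _ 0 :=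
    h3.congr_of_eventuallyEq (Filter.Eventually.of_forall fun s => by
      simp [potential_eq])
  refine h4.congr_deriv ?_
  simp only [Pi.add_apply, Pi.pow_apply, Pi.neg_apply, id_eq, zero_mul, add_zero, potential_eq]
  push_cast
  ring

omit ht ht1 hN in
theorem hasLineDerivAt_eval_mul_conj_eval (q r : Polynomial ℂ) (z v : ℂ) :
    HasLineDerivAt ℝ (fun z : ℂ => q.eval z * conj (r.eval z))
      (v * (q.derivative.eval z * conj (r.eval z)) +
        conj v * (q.eval z * conj (r.derivative.eval z))) z v := by
  unfold HasLineDerivAt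
  have hγ : HasDerivAt (fun s : ℝ => z + s • v) v 0 := by
    simpa using ((hasDerivAt_id (0 : ℝ)).smul_const v).const_add z
  have hq := (q.hasDerivAt (z + (0 : ℝ) • v)).comp (𝕜 := ℝ) (0 : ℝ) hγ
  have hr := ((r.hasDerivAt (z + (0 : ℝ) • v)).comp (𝕜 := ℝ) (0 : ℝ) hγ).star
  refine (hq.mul hr).congr_deriv ?_
  simp only [Function.comp_apply, zero_smul, add_zero, Complex.star_def, map_mul]
  ring

/-- Integration by parts in the direction `v` against the weight `exp(-N V)`. -/
theorem weightedInner_integration_by_parts (q r : Polynomial ℂ) (v : ℂ) :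
    v * weightedInner t N q.derivative r + conj v * weightedInner t N q r.derivative =
      N * (((1 - t) * v.re - (1 + t) * v.im * Complex.I) *
          weightedInner t N (Polynomial.X * q) r +
        ((1 - t) * v.re + (1 + t) * v.im * Complex.I) *
          weightedInner t N q (Polynomial.X * r)) := by
  have hI := integrable_eval_mul_conj_eval ht ht1 hN
  have h1 := ((hI q.derivative r).const_mul v).add ((hI q r.derivative).const_mul (conj v))
  have h2 := ((hI (Polynomial.X * q) r).const_mul
      (N * ((1 - t) * v.re - (1 + t) * v.im * Complex.I))).add
    ((hI q (Polynomial.X * r)).const_mul (N * ((1 - t) * v.re + (1 + t) * v.im * Complex.I)))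
  have e1 : ∀ z : ℂ, (v * (q.derivative.eval z * conj (r.eval z)) +
        conj v * (q.eval z * conj (r.derivative.eval z))) *
          ((Real.exp (-(N * potential t z)) : ℝ) : ℂ) =
      v * (q.derivative.eval z * conj (r.eval z) *
          ((Real.exp (-(N * potential t z)) : ℝ) : ℂ)) +
        conj v * (q.eval z * conj (r.derivative.eval z) *
          ((Real.exp (-(N * potential t z)) : ℝ) : ℂ)) := fun z => by ring
  have e2 : ∀ z : ℂ, q.eval z * conj (r.eval z) *
      (-(2 * N * ((1 - t) * z.re * v.re + (1 + t) * z.im * v.im)) *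
        ((Real.exp (-(N * potential t z)) : ℝ) : ℂ)) =
      -(N * ((1 - t) * v.re - (1 + t) * v.im * Complex.I) *
          ((Polynomial.X * q).eval z * conj (r.eval z) *
            ((Real.exp (-(N * potential t z)) : ℝ) : ℂ)) +
        N * ((1 - t) * v.re + (1 + t) * v.im * Complex.I) *
          (q.eval z * conj ((Polynomial.X * r).eval z) *
            ((Real.exp (-(N * potential t z)) : ℝ) : ℂ))) := fun z => by
    have hz : z = z.re + z.im * Complex.I := (Complex.re_add_im z).symm
    have hzc : conj z = z.re - z.im * Complex.I := by
      apply Complex.ext <;> simp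
    simp only [Polynomial.eval_mul, Polynomial.eval_X, map_mul]
    rw [hzc]
    have e3 : z * q.eval z = (z.re + z.im * Complex.I) * q.eval z := by rw [← hz]
    rw [e3]
    linear_combination (2 * N * (1 + t) * z.im * v.im * q.eval z * conj (r.eval z) *
      ((Real.exp (-(N * potential t z)) : ℝ) : ℂ)) * (-Complex.I_sq)
  have key := integral_bilinear_hasLineDerivAt_right_eq_neg_left_of_integrable
    (μ := (volume : Measure ℂ)) (B := ContinuousLinearMap.mul ℝ ℂ) (v := v)
    (f := fun z : ℂ => q.eval z * conj (r.eval z))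
    (f' := fun z : ℂ => v * (q.derivative.eval z * conj (r.eval z)) +
        conj v * (q.eval z * conj (r.derivative.eval z)))
    (g := fun z : ℂ => ((Real.exp (-(N * potential t z)) : ℝ) : ℂ))
    (g' := fun z : ℂ => -(2 * N * ((1 - t) * z.re * v.re + (1 + t) * z.im * v.im)) *
        ((Real.exp (-(N * potential t z)) : ℝ) : ℂ))
    (h1.congr (Filter.Eventually.of_forall fun z => (e1 z).symm))
    (h2.neg.congr (Filter.Eventually.of_forall fun z => (e2 z).symm))
    (hI q r)
    (fun z _ => hasLineDerivAt_eval_mul_conj_eval q r z v)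
    (fun z _ => hasLineDerivAt_weight z v)
  simp only [ContinuousLinearMap.mul_apply'] at key
  simp_rw [e1, e2] at key
  rw [integral_neg, neg_inj, integral_add, integral_add, integral_const_mul, integral_const_mul,
    integral_const_mul, integral_const_mul] at key
  · unfold weightedInner
    rw [← key]
    ring
  all_goals exact (hI _ _).const_mul _

/-- Up to a multiple of the derivative, multiplication by `z` is adjoint to differentiation. -/
theorem weightedInner_X_mul (q r : Polynomial ℂ) :
    N * (1 - t ^ 2) * weightedInner t N (Polynomial.X * q) r =
      weightedInner t N q r.derivative + t * weightedInner t N q.derivative r := by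
  have h1 := weightedInner_integration_by_parts ht ht1 hN q r 1
  have h2 := weightedInner_integration_by_parts ht ht1 hN q r Complex.I
  simp only [Complex.one_re, Complex.one_im, Complex.I_re, Complex.I_im, map_one, Complex.conj_I,
    Complex.ofReal_zero, Complex.ofReal_one] at h1 h2
  -- Weighting the directions `1` and `I` by `1 + t` and `1 - t` eliminates the term with `X * r`.
  linear_combination (-(1 + t) / 2) * h1 - Complex.I * (1 - t) / 2 * h2 -
    ((1 - t) / 2 * (weightedInner t N q r.derivative - weightedInner t N q.derivative r) -
    N * (1 - t) * (1 + t) / 2 * (weightedInner t N (Polynomial.X * q) r -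
      weightedInner t N q (Polynomial.X * r))) * Complex.I_sq

theorem weightedInner_one_one :
    weightedInner t N 1 1 = ((Real.pi / (N * √(1 - t ^ 2)) : ℝ) : ℂ) := by
  unfold weightedInner
  simp only [Polynomial.eval_one, map_one, mul_one, one_mul]
  rw [integral_complex_ofReal]
  congr 1
  rw [← (Complex.volume_preserving_equiv_real_prod.symm).integral_comp'
    (f := Complex.measurableEquivRealProd.symm)]
  have h : ∀ p : ℝ × ℝ, Real.exp (-(N * potential t (Complex.measurableEquivRealProd.symm p))) =
      Real.exp (-(N * (1 - t)) * p.1 ^ 2) * Real.exp (-(N * (1 + t)) * p.2 ^ 2) := fun p => by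
    rw [potential_eq, ← Real.exp_add, Complex.measurableEquivRealProd_symm_apply]
    congr 1
    ring
  simp_rw [h]
  rw [Measure.volume_eq_prod, integral_prod_mul (fun x : ℝ => Real.exp (-(N * (1 - t)) * x ^ 2))
    (fun x : ℝ => Real.exp (-(N * (1 + t)) * x ^ 2)), integral_gaussian, integral_gaussian]
  have h1 : 0 < 1 - t := by linarith
  have h2 : 0 < 1 + t := by linarith
  rw [← Real.sqrt_mul (by positivity)]
  have : Real.pi / (N * (1 - t)) * (Real.pi / (N * (1 + t))) =
      (Real.pi / N) ^ 2 / (1 - t ^ 2) := by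
    have h3 : 1 - t ^ 2 = (1 - t) * (1 + t) := by ring
    rw [h3]
    field_simp
  rw [this, Real.sqrt_div (by positivity), Real.sqrt_sq (by positivity), div_div]

end WeightedInner

/-! ### Explicit orthogonal polynomials -/

theorem hermiteSeq_succ {R : Type*} [CommRing R] (a b : R) (j : ℕ) :
    hermiteSeq a b (j + 1) = a * hermiteSeq a b j + b * j * hermiteSeq a b (j - 1) := by
  rcases j with _ | j
  · simp
  · rw [hermiteSeq_add_two]
    simp

/-- The coefficient `N (1 - t²)`. -/
def hermiteRate (t N : ℝ) : ℝ := N * (1 - t ^ 2)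

/-- The unnormalized orthogonal polynomials for the weight `exp(-N V)`. -/
noncomputable def ellipticHermite (t N : ℝ) (j : ℕ) : Polynomial ℂ :=
  hermiteSeq (Polynomial.C (hermiteRate t N : ℂ) * Polynomial.X)
    (Polynomial.C (-(t * hermiteRate t N) : ℂ)) j

theorem hermiteRate_pos {t N : ℝ} (ht : 0 ≤ t) (ht1 : t < 1) (hN : 0 < N) :
    0 < hermiteRate t N := by
  have : 0 < 1 - t ^ 2 := by nlinarith
  exact mul_pos hN this

theorem eval_ellipticHermite (t N : ℝ) (j : ℕ) (z : ℂ) : (ellipticHermite t N j).eval z =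
    hermiteSeq (hermiteRate t N * z) (-(t * hermiteRate t N)) j := by
  have := map_hermiteSeq (Polynomial.evalRingHom z)
    (Polynomial.C (hermiteRate t N : ℂ) * Polynomial.X)
    (Polynomial.C (-(t * hermiteRate t N) : ℂ)) j
  simpa [ellipticHermite] using this

theorem conj_eval_ellipticHermite (t N : ℝ) (j : ℕ) (z : ℂ) :
    conj ((ellipticHermite t N j).eval z) = (ellipticHermite t N j).eval (conj z) := by
  rw [eval_ellipticHermite, eval_ellipticHermite, map_hermiteSeq]
  simp

/-- The Appell property: differentiation lowers the index, so it plays the role of an annihilation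
operator. -/
theorem derivative_ellipticHermite (t N : ℝ) (j : ℕ) :
    (ellipticHermite t N j).derivative =
      Polynomial.C (hermiteRate t N * j : ℂ) * ellipticHermite t N (j - 1) := by
  induction j using Nat.twoStepInduction with
  | zero => simp [ellipticHermite]
  | one => simp [ellipticHermite]
  | more j h0 h1 =>
    have e := hermiteSeq_succ (Polynomial.C (hermiteRate t N : ℂ) * Polynomial.X)
      (Polynomial.C (-(t * hermiteRate t N) : ℂ)) j
    change ellipticHermite t N (j + 1) = _ * ellipticHermite t N j +
      _ * _ * ellipticHermite t N (j - 1) at e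
    have e2 : ellipticHermite t N (j + 2) = Polynomial.C (hermiteRate t N : ℂ) * Polynomial.X *
        ellipticHermite t N (j + 1) + Polynomial.C (-(t * hermiteRate t N) : ℂ) *
          ((j : Polynomial ℂ) + 1) * ellipticHermite t N j := hermiteSeq_add_two _ _ j
    rw [e2]
    simp only [Polynomial.derivative_add, Polynomial.derivative_mul, Polynomial.derivative_C,
      Polynomial.derivative_X, Polynomial.derivative_natCast, Polynomial.derivative_one, h0, h1,
      Nat.add_sub_cancel, show j + 2 - 1 = j + 1 by omega]
    push_cast
    simp only [map_mul, map_add, map_one, map_natCast, map_ofNat]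
    linear_combination (-((j : Polynomial ℂ) + 1) * Polynomial.C (hermiteRate t N : ℂ)) * e

/-- Exhibits the passage to the next index as the raising operator that `weightedInner_X_mul`
identifies as the adjoint of differentiation. -/
theorem ellipticHermite_succ (t N : ℝ) (j : ℕ) : ellipticHermite t N (j + 1) =
    Polynomial.C (hermiteRate t N : ℂ) * (Polynomial.X * ellipticHermite t N j) +
      Polynomial.C (-t : ℂ) * (ellipticHermite t N j).derivative := by
  have e := hermiteSeq_succ (Polynomial.C (hermiteRate t N : ℂ) * Polynomial.X)
    (Polynomial.C (-(t * hermiteRate t N) : ℂ)) j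
  change ellipticHermite t N (j + 1) = _ * ellipticHermite t N j +
    _ * _ * ellipticHermite t N (j - 1) at e
  rw [e, derivative_ellipticHermite]
  simp only [map_mul, map_neg, map_natCast]
  ring

theorem degree_ellipticHermite {t N : ℝ} (ht : 0 ≤ t) (ht1 : t < 1) (hN : 0 < N) (j : ℕ) :
    (ellipticHermite t N j).degree = (j : WithBot ℕ) := by
  have hκ : (hermiteRate t N : ℂ) ≠ 0 := by exact_mod_cast (hermiteRate_pos ht ht1 hN).ne'
  induction j with
  | zero => simp [ellipticHermite]
  | succ j ih =>
    have h1 : (Polynomial.C (hermiteRate t N : ℂ) *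
        (Polynomial.X * ellipticHermite t N j)).degree = ((j + 1 : ℕ) : WithBot ℕ) := by
      rw [Polynomial.degree_C_mul hκ, mul_comm, Polynomial.degree_mul_X, ih]
      rfl
    rw [ellipticHermite_succ, Polynomial.degree_add_eq_left_of_degree_lt, h1]
    rw [h1]
    rw [← Polynomial.smul_eq_C_mul]
    refine (Polynomial.degree_smul_le _ _).trans_lt ?_
    refine (Polynomial.degree_derivative_le).trans_lt ?_
    rw [ih]
    exact_mod_cast j.lt_succ_self

section Orthonormality

variable {t N : ℝ} (ht : 0 ≤ t) (ht1 : t < 1) (hN : 0 < N)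
include ht ht1 hN

theorem weightedInner_ellipticHermite_succ (j : ℕ) (r : Polynomial ℂ) :
    weightedInner t N (ellipticHermite t N (j + 1)) r =
      weightedInner t N (ellipticHermite t N j) r.derivative := by
  rw [ellipticHermite_succ, weightedInner_add_left ht ht1 hN, weightedInner_C_mul_left,
    weightedInner_C_mul_left]
  have h := weightedInner_X_mul ht ht1 hN (ellipticHermite t N j) r
  have h2 : (hermiteRate t N : ℂ) = N * (1 - t ^ 2) := by rw [hermiteRate]; push_cast; ring
  rw [h2, h]
  ring

/-- Each raising step on the left becomes a derivative on the right, which lowers `k` and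
contributes a factor `hermiteRate t N * k`; the process ends at a constant. -/
theorem weightedInner_ellipticHermite (j k : ℕ) :
    weightedInner t N (ellipticHermite t N j) (ellipticHermite t N k) =
      if j = k then ((hermiteRate t N ^ j * j.factorial *
        (Real.pi / (N * √(1 - t ^ 2))) : ℝ) : ℂ) else 0 := by
  have h0 : ellipticHermite t N 0 = 1 := rfl
  have hz : ∀ q : Polynomial ℂ, weightedInner t N q 0 = 0 := fun q => by simp [weightedInner]
  induction j generalizing k with
  | zero =>
    rcases k with _ | k
    · rw [h0, weightedInner_one_one ht ht1 hN]
      simp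
    · rw [← conj_weightedInner, weightedInner_ellipticHermite_succ ht ht1 hN, h0,
        Polynomial.derivative_one, hz]
      simp
  | succ j ih =>
    rw [weightedInner_ellipticHermite_succ ht ht1 hN, derivative_ellipticHermite,
      weightedInner_C_mul_right, ih]
    rcases k with _ | k
    · simp
    · simp only [Nat.add_sub_cancel, add_left_inj]
      split_ifs with h
      · subst h
        rw [← Complex.ofReal_natCast, ← Complex.ofReal_mul, Complex.conj_ofReal,
          ← Complex.ofReal_mul, Nat.factorial_succ]
        congr 1
        push_cast
        ring
      · simp

end Orthonormality

/-- The factor which turns `ellipticHermite` into an orthonormal system, divided by `√N`. -/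
noncomputable def normalizer (t N : ℝ) (j : ℕ) : ℝ :=
  √(√(1 - t ^ 2) / (Real.pi * hermiteRate t N ^ j * j.factorial))

/-- The explicit orthonormal polynomials. -/
noncomputable def orthonormalHermite (t N : ℝ) (j : ℕ) : Polynomial ℂ :=
  Polynomial.C ((√N * normalizer t N j : ℝ) : ℂ) * ellipticHermite t N j

section Orthonormal

variable {t N : ℝ} (ht : 0 ≤ t) (ht1 : t < 1) (hN : 0 < N)
include ht ht1 hN

omit hN in
theorem one_sub_sq_pos : 0 < 1 - t ^ 2 := by nlinarith

theorem normalizer_sq (j : ℕ) : normalizer t N j ^ 2 =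
    √(1 - t ^ 2) / (Real.pi * hermiteRate t N ^ j * j.factorial) := by
  have := hermiteRate_pos ht ht1 hN
  rw [normalizer, Real.sq_sqrt (by positivity)]

theorem normalizer_pos (j : ℕ) : 0 < normalizer t N j := by
  have := hermiteRate_pos ht ht1 hN
  have := one_sub_sq_pos ht ht1
  rw [normalizer]
  positivity

theorem isOrthonormalPolynomials_orthonormalHermite :
    IsOrthonormalPolynomials t N (orthonormalHermite t N) where
  degree_eq j := by
    have := normalizer_pos ht ht1 hN j
    have h : ((√N * normalizer t N j : ℝ) : ℂ) ≠ 0 := by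
      have : √N * normalizer t N j ≠ 0 := by positivity
      exact_mod_cast this
    rw [orthonormalHermite, Polynomial.degree_C_mul h, degree_ellipticHermite ht ht1 hN]
  integrable j k := integrable_eval_mul_conj_eval ht ht1 hN _ _
  orthonormal j k := by
    change weightedInner t N (orthonormalHermite t N j) (orthonormalHermite t N k) = _
    rw [orthonormalHermite, orthonormalHermite, weightedInner_C_mul_left,
      weightedInner_C_mul_right, weightedInner_ellipticHermite ht ht1 hN]
    split_ifs with h
    · subst h
      rw [Complex.conj_ofReal, ← Complex.ofReal_mul, ← Complex.ofReal_mul]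
      have h1 := normalizer_sq ht ht1 hN j
      have h2 := Real.sq_sqrt hN.le
      have h3 := hermiteRate_pos ht ht1 hN
      have h4 := one_sub_sq_pos ht ht1
      rw [← mul_assoc, ← pow_two, mul_pow, h1, h2]
      have h5 : √(1 - t ^ 2) ≠ 0 := by positivity
      have : N * (√(1 - t ^ 2) / (Real.pi * hermiteRate t N ^ j * j.factorial)) *
          (hermiteRate t N ^ j * j.factorial * (Real.pi / (N * √(1 - t ^ 2)))) = 1 := by
        field_simp
      rw [this, Complex.ofReal_one]
    · simp

end Orthonormal

/-! ### Uniqueness of orthonormal systems -/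

namespace IsOrthonormalPolynomials

variable {t N : ℝ} {p : ℕ → Polynomial ℂ}

theorem weightedInner_eq (hp : IsOrthonormalPolynomials t N p) (j k : ℕ) :
    weightedInner t N (p j) (p k) = if j = k then 1 else 0 :=
  hp.orthonormal j k

theorem exists_eq_C_mul_add (hp : IsOrthonormalPolynomials t N p) {d : ℕ} {q : Polynomial ℂ}
    (hq : q.degree < (d + 1 : ℕ)) :
    ∃ (c : ℂ) (q' : Polynomial ℂ), q'.degree < d ∧ q = Polynomial.C c * p d + q' := by
  have hlc : (p d).coeff d ≠ 0 := Polynomial.coeff_ne_zero_of_eq_degree (hp.degree_eq d)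
  refine ⟨q.coeff d / (p d).coeff d, q - Polynomial.C (q.coeff d / (p d).coeff d) * p d, ?_,
    by ring⟩
  rw [Polynomial.degree_lt_iff_coeff_zero] at hq ⊢
  intro m hm
  rw [Polynomial.coeff_sub, Polynomial.coeff_C_mul]
  rcases hm.eq_or_lt with rfl | hm
  · field_simp
    simp
  · rw [hq m hm, Polynomial.coeff_eq_zero_of_degree_lt (n := m) (p := p d)
      (by rw [hp.degree_eq]; exact_mod_cast hm)]
    simp

theorem weightedInner_eq_zero_of_degree_lt (hp : IsOrthonormalPolynomials t N p)
    (ht : 0 ≤ t) (ht1 : t < 1) (hN : 0 < N) {d : ℕ} {q : Polynomial ℂ} (hq : q.degree < d)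
    {k : ℕ} (hk : d ≤ k) : weightedInner t N q (p k) = 0 := by
  induction d generalizing q with
  | zero =>
    have : q = 0 := by simpa using hq
    simp [this, weightedInner]
  | succ d ih =>
    obtain ⟨c, q', hq', rfl⟩ := hp.exists_eq_C_mul_add hq
    rw [weightedInner_add_left ht ht1 hN, weightedInner_C_mul_left, ih hq' (by omega),
      hp.weightedInner_eq, if_neg (by omega)]
    simp

/-- A polynomial of degree less than `j` orthogonal to `p 0, …, p (j - 1)` is zero. -/
theorem eq_zero_of_degree_lt (hp : IsOrthonormalPolynomials t N p)
    (ht : 0 ≤ t) (ht1 : t < 1) (hN : 0 < N) {j : ℕ} {q : Polynomial ℂ} (hq : q.degree < j)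
    (h : ∀ k < j, weightedInner t N q (p k) = 0) : q = 0 := by
  induction j generalizing q with
  | zero => simpa using hq
  | succ j ih =>
    obtain ⟨c, q', hq', rfl⟩ := hp.exists_eq_C_mul_add hq
    have hc := h j (by omega)
    rw [weightedInner_add_left ht ht1 hN, weightedInner_C_mul_left, hp.weightedInner_eq,
      hp.weightedInner_eq_zero_of_degree_lt ht ht1 hN hq' le_rfl] at hc
    have hc0 : c = 0 := by simpa using hc
    have hq0 : Polynomial.C c * p j + q' = q' := by simp [hc0]
    rw [hq0] at h ⊢
    exact ih hq' fun k hk => h k (by omega)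

/-- Orthonormal polynomials are unique up to unimodular constants. -/
theorem exists_unimodular (hp : IsOrthonormalPolynomials t N p)
    {P : ℕ → Polynomial ℂ} (hP : IsOrthonormalPolynomials t N P)
    (ht : 0 ≤ t) (ht1 : t < 1) (hN : 0 < N) (j : ℕ) :
    ∃ c : ℂ, c * conj c = 1 ∧ P j = Polynomial.C c * p j := by
  obtain ⟨c, q, hq, hPj⟩ := hp.exists_eq_C_mul_add (d := j) (q := P j)
    (by rw [hP.degree_eq]; exact_mod_cast j.lt_succ_self)
  have hq0 : q = 0 := by
    refine hp.eq_zero_of_degree_lt ht ht1 hN hq fun k hk => ?_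
    have h1 : weightedInner t N (P j) (p k) = 0 := by
      rw [← conj_weightedInner, hP.weightedInner_eq_zero_of_degree_lt ht ht1 hN (d := j)
        (by rw [hp.degree_eq]; exact_mod_cast hk) le_rfl, map_zero]
    rw [hPj, weightedInner_add_left ht ht1 hN, weightedInner_C_mul_left, hp.weightedInner_eq,
      if_neg (by omega)] at h1
    simpa using h1
  rw [hq0, add_zero] at hPj
  refine ⟨c, ?_, hPj⟩
  have h1 := hP.weightedInner_eq j j
  rw [hPj, weightedInner_C_mul_left, weightedInner_C_mul_right, hp.weightedInner_eq] at h1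
  simpa using h1

end IsOrthonormalPolynomials

/-! ### Weighted sums of wave functions -/

/-- The weighted orthonormal functions `P_j(z) exp(-N V(z) / 2) / √N`. -/
noncomputable def waveFunction (t N : ℝ) (j : ℕ) (z : ℂ) : ℂ :=
  normalizer t N j * (ellipticHermite t N j).eval z *
    ((Real.exp (-(N * potential t z) / 2) : ℝ) : ℂ)

theorem corrKernel_eq_sum_waveFunction {t N : ℝ} (ht : 0 ≤ t) (ht1 : t < 1) (hN : 0 < N)
    {p : ℕ → Polynomial ℂ} (hp : IsOrthonormalPolynomials t N p) (n : ℕ) (z w : ℂ) :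
    (1 / (N : ℂ)) * corrKernel t N p n z w =
      ∑ j ∈ Finset.range n, waveFunction t N j z * conj (waveFunction t N j w) := by
  rw [corrKernel, Finset.mul_sum]
  refine Finset.sum_congr rfl fun j _ => ?_
  obtain ⟨c, hc, h⟩ := (isOrthonormalPolynomials_orthonormalHermite ht ht1 hN).exists_unimodular
    hp ht ht1 hN j
  have hNc : (N : ℂ) ≠ 0 := by exact_mod_cast hN.ne'
  have hs : ((√N : ℝ) : ℂ) * ((√N : ℝ) : ℂ) = N := by
    rw [← Complex.ofReal_mul, Real.mul_self_sqrt hN.le]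
  simp only [h, orthonormalHermite, waveFunction, Polynomial.eval_mul, Polynomial.eval_C, map_mul,
    Complex.conj_ofReal, Complex.ofReal_mul]
  rw [one_div, inv_mul_eq_iff_eq_mul₀ hNc, ← hs]
  linear_combination (((√N : ℝ) : ℂ) * ((√N : ℝ) : ℂ) * normalizer t N j ^ 2 *
    (ellipticHermite t N j).eval z * conj ((ellipticHermite t N j).eval w) *
    ((Real.exp (-(N * potential t z) / 2) : ℝ) : ℂ) *
    ((Real.exp (-(N * potential t w) / 2) : ℝ) : ℂ)) * hc

/-- Mehler's formula at `z` and `conj w`: the coefficients are real, so conjugating the value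
conjugates the argument. -/
theorem hasSum_pow_mul_waveFunction {t N r : ℝ} (ht : 0 ≤ t) (ht1 : t < 1) (hN : 0 < N)
    (hr : 0 ≤ r) (hrt : t * r < 1) (z w : ℂ) :
    HasSum (fun j : ℕ => (r : ℂ) ^ j * (waveFunction t N j z * conj (waveFunction t N j w)))
      (((√(1 - t ^ 2) / (Real.pi * √(1 - t ^ 2 * r ^ 2)) : ℝ) : ℂ) * Complex.exp
        (((hermiteRate t N / (1 - t ^ 2 * r ^ 2) : ℝ) : ℂ) *
          (r * z * conj w - t * r ^ 2 * (z ^ 2 + conj w ^ 2) / 2) -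
          ((N * potential t z / 2 + N * potential t w / 2 : ℝ) : ℂ))) := by
  have hκ := hermiteRate_pos ht ht1 hN
  have h := (hasSum_mehler ht hκ hr hrt z (conj w)).mul_left
    (((√(1 - t ^ 2) / Real.pi : ℝ) : ℂ) *
      (((Real.exp (-(N * potential t z) / 2) : ℝ) : ℂ) *
        ((Real.exp (-(N * potential t w) / 2) : ℝ) : ℂ)))
  convert h using 1
  · rfl
  · funext j
    have h1 : (normalizer t N j : ℂ) * normalizer t N j =
        ((√(1 - t ^ 2) / (Real.pi * hermiteRate t N ^ j * j.factorial) : ℝ) : ℂ) := by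
      rw [← normalizer_sq ht ht1 hN, ← Complex.ofReal_mul, pow_two]
    simp only [waveFunction, map_mul, Complex.conj_ofReal, conj_eval_ellipticHermite]
    simp only [eval_ellipticHermite]
    have h2 : (r : ℂ) ^ j * ((normalizer t N j : ℂ) * normalizer t N j) =
        ((√(1 - t ^ 2) / Real.pi : ℝ) : ℂ) * ((r / hermiteRate t N : ℝ) : ℂ) ^ j /
          (j.factorial : ℂ) := by
      rw [h1]
      have hκ' : (hermiteRate t N : ℂ) ≠ 0 := by exact_mod_cast hκ.ne'
      push_cast
      rw [div_pow]
      field_simp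
    linear_combination (hermiteSeq (hermiteRate t N * z) (-(t * hermiteRate t N : ℂ)) j *
      hermiteSeq (hermiteRate t N * conj w) (-(t * hermiteRate t N : ℂ)) j *
      ((Real.exp (-(N * potential t z) / 2) : ℝ) : ℂ) *
        ((Real.exp (-(N * potential t w) / 2) : ℝ) : ℂ)) * h2
  · have e : ((Real.exp (-(N * potential t z) / 2) : ℝ) : ℂ) *
        ((Real.exp (-(N * potential t w) / 2) : ℝ) : ℂ) =
        Complex.exp (-((N * potential t z / 2 + N * potential t w / 2 : ℝ) : ℂ)) := by
      rw [← Complex.ofReal_mul, ← Real.exp_add, ← Complex.ofReal_neg, ← Complex.ofReal_exp]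
      congr 2
      ring
    rw [e, Complex.exp_sub, Complex.exp_neg, Complex.ofReal_inv]
    simp only [Complex.ofReal_div, Complex.ofReal_mul Real.pi]
    ring

/-- The quadratic form governing the exponential growth of the weighted sums. -/
noncomputable def ellipseForm (t r : ℝ) (z : ℂ) : ℝ :=
  (1 - t) / (1 + t * r) * z.re ^ 2 + (1 + t) / (1 - t * r) * z.im ^ 2

/-- On the diagonal the exponent is real and vanishes at `r = 1`, so `r - 1` factors out; what
remains is `ellipseForm`, which at `r = 1` defines the droplet. -/
theorem hasSum_pow_mul_norm_sq_waveFunction {t N r : ℝ} (ht : 0 ≤ t) (ht1 : t < 1) (hN : 0 < N)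
    (hr : 0 ≤ r) (hrt : t * r < 1) (z : ℂ) :
    HasSum (fun j : ℕ => r ^ j * ‖waveFunction t N j z‖ ^ 2)
      (√(1 - t ^ 2) / (Real.pi * √(1 - t ^ 2 * r ^ 2)) *
        Real.exp (N * ((r - 1) * ellipseForm t r z))) := by
  rw [← Complex.hasSum_ofReal]
  have h := hasSum_pow_mul_waveFunction ht ht1 hN hr hrt z z
  convert h using 1
  · funext j
    rw [Complex.mul_conj, Complex.normSq_eq_norm_sq]
    push_cast
    rfl
  · rw [Complex.ofReal_mul, Complex.ofReal_exp]
    congr 2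
    have hz : z = z.re + z.im * Complex.I := (Complex.re_add_im z).symm
    have hzc : conj z = z.re - z.im * Complex.I := by
      apply Complex.ext <;> simp
    have e1 : z * conj z = ((z.re ^ 2 + z.im ^ 2 : ℝ) : ℂ) := by
      rw [Complex.mul_conj, Complex.normSq_apply]; congr 1; ring
    have e2 : z ^ 2 + conj z ^ 2 = ((2 * (z.re ^ 2 - z.im ^ 2) : ℝ) : ℂ) := by
      rw [hzc]
      nth_rw 1 [hz]
      push_cast
      linear_combination 2 * (z.im : ℂ) ^ 2 * Complex.I_sq
    rw [mul_assoc (r : ℂ), e1, e2]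
    norm_cast
    rw [potential_eq, ellipseForm, hermiteRate]
    have h1 : 1 - t * r ≠ 0 := by linarith
    have h1' : 1 - r * t ≠ 0 := by linarith
    have h2 : 1 + t * r ≠ 0 := by positivity
    have h3 : 1 - t ^ 2 * r ^ 2 = (1 - t * r) * (1 + t * r) := by ring
    rw [h3]
    field_simp
    ring

theorem hasSum_waveFunction {t N : ℝ} (ht : 0 ≤ t) (ht1 : t < 1) (hN : 0 < N) (z w : ℂ) :
    HasSum (fun j : ℕ => waveFunction t N j z * conj (waveFunction t N j w))
      ((1 / (Real.pi : ℂ)) * ((Real.exp (-(N / 2) * ‖z - w‖ ^ 2) : ℝ) : ℂ) *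
        Complex.exp (Complex.I * (N : ℂ) * (((z * conj w - (t : ℂ) / 2 * z ^ 2 -
          (t : ℂ) / 2 * (conj w) ^ 2).im : ℝ) : ℂ))) := by
  have h := hasSum_pow_mul_waveFunction ht ht1 hN zero_le_one (by linarith) z w
  simp only [Complex.ofReal_one, one_pow, one_mul, mul_one] at h
  convert h using 1
  have h0 := one_sub_sq_pos ht ht1
  have e1 : √(1 - t ^ 2) / (Real.pi * √(1 - t ^ 2)) = 1 / Real.pi := by
    have : √(1 - t ^ 2) ≠ 0 := by positivity
    field_simp
  have e2 : hermiteRate t N / (1 - t ^ 2) = N := by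
    rw [hermiteRate]
    field_simp
  rw [e1, e2, Complex.ofReal_exp, mul_assoc, ← Complex.exp_add, Complex.ofReal_div,
    Complex.ofReal_one]
  congr 2
  have hn : ‖z - w‖ ^ 2 = (z.re - w.re) ^ 2 + (z.im - w.im) ^ 2 := by
    rw [Complex.sq_norm, Complex.normSq_apply]
    simp only [Complex.sub_re, Complex.sub_im]
    ring
  rw [hn, potential_eq, potential_eq]
  apply Complex.ext
  · simp [pow_two]
    ring
  · simp [pow_two]
    left
    ring

/-! ### Geometry of the droplet -/

theorem mem_droplet_iff {t T : ℝ} {z : ℂ} : z ∈ droplet t T ↔ ellipseForm t 1 z ≤ T := by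
  simp [droplet, ellipseForm]

theorem continuous_ellipseForm (t r : ℝ) : Continuous (ellipseForm t r) := by
  unfold ellipseForm
  fun_prop

/-- The form is homogeneous of degree two, so a point at level `T` or above leaves the droplet under
any dilation by `1 + s` with `s > 0`. -/
theorem ellipseForm_lt_of_mem_interior {t T : ℝ} (hT : 0 < T) {z : ℂ}
    (hz : z ∈ interior (droplet t T)) : ellipseForm t 1 z < T := by
  by_contra! h
  have hc : Filter.Tendsto (fun s : ℝ => ((1 + s : ℝ) : ℂ) * z) (𝓝[>] 0) (𝓝 z) := by
    have : Continuous fun s : ℝ => ((1 + s : ℝ) : ℂ) * z := by fun_prop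
    have h1 := this.tendsto 0
    simp only [add_zero, Complex.ofReal_one, one_mul] at h1
    exact h1.mono_left nhdsWithin_le_nhds
  have h1 := hc.eventually (mem_interior_iff_mem_nhds.1 hz)
  obtain ⟨s, hs, hs0⟩ := (h1.and self_mem_nhdsWithin).exists
  have hs0 : 0 < s := hs0
  have hs : ellipseForm t 1 (((1 + s : ℝ) : ℂ) * z) ≤ T := mem_droplet_iff.1 hs
  have h2 : ellipseForm t 1 (((1 + s : ℝ) : ℂ) * z) = (1 + s) ^ 2 * ellipseForm t 1 z := by
    simp only [ellipseForm, Complex.re_ofReal_mul, Complex.im_ofReal_mul]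
    ring
  rw [h2] at hs
  nlinarith [mul_pos hs0 hT, mul_pos (mul_pos hs0 hs0) hT,
    mul_le_mul_of_nonneg_left h (sq_nonneg (1 + s))]

theorem exists_ellipseForm_le_of_isCompact {t T : ℝ} (hT : 0 < T) {S : Set ℂ}
    (hS : IsCompact S) (hST : S ⊆ interior (droplet t T)) :
    ∃ η : ℝ, 0 < η ∧ ∀ z ∈ S, ellipseForm t 1 z ≤ T - η := by
  rcases S.eq_empty_or_nonempty with rfl | hne
  · exact ⟨1, one_pos, by simp⟩
  · obtain ⟨z₀, hz₀, hmax⟩ := hS.exists_isMaxOn hne (continuous_ellipseForm t 1).continuousOn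
    refine ⟨T - ellipseForm t 1 z₀,
      sub_pos.2 (ellipseForm_lt_of_mem_interior hT (hST hz₀)), fun z hz => ?_⟩
    have : ellipseForm t 1 z ≤ ellipseForm t 1 z₀ := hmax hz
    linarith

theorem norm_sq_le_ellipseForm {t : ℝ} (ht : 0 ≤ t) (ht1 : t < 1) (z : ℂ) :
    (1 - t) / (1 + t) * ‖z‖ ^ 2 ≤ ellipseForm t 1 z := by
  have h : (1 - t) / (1 + t) ≤ (1 + t) / (1 - t) := by
    rw [div_le_div_iff₀ (by linarith) (by linarith)]
    nlinarith
  rw [ellipseForm, Complex.sq_norm, Complex.normSq_apply, mul_one]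
  nlinarith [mul_le_mul_of_nonneg_right h (sq_nonneg z.im)]

theorem exists_le_ellipseForm_of_mem_nhdsSet {t T : ℝ} (ht : 0 ≤ t) (ht1 : t < 1)
    {U : Set ℂ} (hU : U ∈ 𝓝ˢ (droplet t T)) :
    ∃ η : ℝ, 0 < η ∧ ∀ z ∉ U, T + η ≤ ellipseForm t 1 z := by
  -- Only the points outside `U` at level at most `T + 1` need compactness; the higher ones satisfy
  -- the bound with `η = 1`.
  set A : Set ℂ := {z | ellipseForm t 1 z ≤ T + 1} ∩ (interior U)ᶜ with hA
  have hsub : droplet t T ⊆ interior U := subset_interior_iff_mem_nhdsSet.2 hU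
  have hcl : IsClosed A := (isClosed_le (continuous_ellipseForm t 1) continuous_const).inter
    isOpen_interior.isClosed_compl
  have hc0 : 0 < (1 - t) / (1 + t) := div_pos (by linarith) (by linarith)
  have hbd : Bornology.IsBounded A := by
    rw [isBounded_iff_forall_norm_le]
    refine ⟨(T + 1) / ((1 - t) / (1 + t)) + 1, fun z hz => ?_⟩
    have h1 : (1 - t) / (1 + t) * ‖z‖ ^ 2 ≤ T + 1 :=
      (norm_sq_le_ellipseForm ht ht1 z).trans hz.1
    have h2 : ‖z‖ ^ 2 ≤ (T + 1) / ((1 - t) / (1 + t)) := by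
      rw [le_div_iff₀ hc0]
      linarith
    nlinarith [sq_nonneg (‖z‖ - 1), norm_nonneg z]
  have hcomp : IsCompact A := Metric.isCompact_of_isClosed_isBounded hcl hbd
  rcases A.eq_empty_or_nonempty with hemp | hne
  · refine ⟨1, one_pos, fun z hz => ?_⟩
    by_contra! h
    have : z ∈ A := ⟨h.le, fun h' => hz (interior_subset h')⟩
    simp [hemp] at this
  · obtain ⟨z₀, hz₀, hmin⟩ := hcomp.exists_isMinOn hne (continuous_ellipseForm t 1).continuousOn
    have hlt : T < ellipseForm t 1 z₀ := by
      by_contra! h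
      exact hz₀.2 (hsub (mem_droplet_iff.2 h))
    refine ⟨min 1 (ellipseForm t 1 z₀ - T), lt_min one_pos (sub_pos.2 hlt), fun z hz => ?_⟩
    by_cases h : ellipseForm t 1 z ≤ T + 1
    · have h1 : ellipseForm t 1 z₀ ≤ ellipseForm t 1 z :=
        hmin (⟨h, fun h' => hz (interior_subset h')⟩ : z ∈ A)
      linarith [min_le_right 1 (ellipseForm t 1 z₀ - T)]
    · linarith [min_le_left 1 (ellipseForm t 1 z₀ - T)]

/-- Comparison of coefficients: the imaginary ones agree exactly, the real ones are ordered because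
`r ≥ 1`. It makes the choice of `r` uniform in `z`. -/
theorem ellipseForm_le {t r : ℝ} (ht : 0 ≤ t) (ht1 : t < 1) (hr : 1 ≤ r) (hrt : t * r < 1)
    (z : ℂ) : ellipseForm t r z ≤ (1 - t) / (1 - t * r) * ellipseForm t 1 z := by
  have hp : 0 < 1 - t := by linarith
  have hp' : 0 < 1 - t * r := by linarith
  have h1 : (1 - t) / (1 + t * r) ≤ (1 - t) / (1 - t * r) * ((1 - t) / (1 + t)) := by
    rw [div_mul_div_comm, div_le_div_iff₀ (by nlinarith) (by positivity)]
    have : (1 - t * r) * (1 + t) ≤ (1 - t) * (1 + t * r) := by nlinarith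
    nlinarith [mul_le_mul_of_nonneg_left this hp.le]
  have h2 : (1 + t) / (1 - t * r) = (1 - t) / (1 - t * r) * ((1 + t) / (1 - t)) := by
    field_simp
  rw [ellipseForm, ellipseForm, h2, mul_one]
  nlinarith [mul_le_mul_of_nonneg_right h1 (sq_nonneg z.re)]

theorem le_ellipseForm {t r : ℝ} (ht : 0 ≤ t) (ht1 : t < 1) (hr0 : 0 < r) (hr : r ≤ 1)
    (z : ℂ) : (1 - t) / (1 - t * r) * ellipseForm t 1 z ≤ ellipseForm t r z := by
  have hp : 0 < 1 - t := by linarith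
  have hp' : 0 < 1 - t * r := by nlinarith
  have h1 : (1 - t) / (1 - t * r) * ((1 - t) / (1 + t)) ≤ (1 - t) / (1 + t * r) := by
    rw [div_mul_div_comm, div_le_div_iff₀ (by positivity) (by positivity)]
    have : (1 - t) * (1 + t * r) ≤ (1 - t * r) * (1 + t) := by nlinarith
    nlinarith [mul_le_mul_of_nonneg_left this hp.le]
  have h2 : (1 + t) / (1 - t * r) = (1 - t) / (1 - t * r) * ((1 + t) / (1 - t)) := by
    field_simp
  rw [ellipseForm, ellipseForm, h2, mul_one]
  nlinarith [mul_le_mul_of_nonneg_right h1 (sq_nonneg z.re)]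

/-! ### Choice of the Chernoff parameter -/

theorem exists_rate_interior {t η : ℝ} (T : ℝ) (ht : 0 ≤ t) (ht1 : t < 1) (hT : 0 < T)
    (hη : 0 < η) : ∃ r : ℝ, 1 < r ∧ t * r < 1 ∧ ∃ ε : ℝ, 0 < ε ∧ ∀ z : ℂ,
      ellipseForm t 1 z ≤ T - η → (r - 1) * ellipseForm t r z - T * Real.log r ≤ -ε := by
  have hp : 1 - t ≠ 0 := by linarith
  -- By `ellipseForm_le` and `log r ≥ 1 - 1/r`, the exponent is at most `r - 1` times this function,
  -- whose value at `r = 1` is `-η`; by continuity it stays below `-η/2` nearby.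
  have hcont : ContinuousAt (fun r : ℝ => (1 - t) / (1 - t * r) * (T - η) - T * r⁻¹) 1 := by
    have : 1 - t * 1 ≠ 0 := by simpa using hp
    fun_prop (disch := first | assumption | norm_num)
  have hval : (1 - t) / (1 - t * 1) * (T - η) - T * (1 : ℝ)⁻¹ < -(η / 2) := by
    rw [mul_one, div_self hp]
    linarith
  have h1 := hcont.eventually_lt continuousAt_const hval
  have h2 : ∀ᶠ r : ℝ in 𝓝 1, t * r < 1 :=
    (by fun_prop : ContinuousAt (fun r : ℝ => t * r) 1).eventually_lt continuousAt_const
      (by simpa using ht1)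
  obtain ⟨r, ⟨hr1, hr2⟩, hr3⟩ :=
    (((h1.and h2).filter_mono nhdsWithin_le_nhds).and
      (self_mem_nhdsWithin : Set.Ioi (1 : ℝ) ∈ 𝓝[>] 1)).exists
  have hr3 : 1 < r := hr3
  refine ⟨r, hr3, hr2, (r - 1) * (η / 2), mul_pos (by linarith) (by linarith), fun z hz => ?_⟩
  have h3 := ellipseForm_le ht ht1 hr3.le hr2 z
  have h4 : (1 - t) / (1 - t * r) * ellipseForm t 1 z ≤ (1 - t) / (1 - t * r) * (T - η) :=
    mul_le_mul_of_nonneg_left hz (div_nonneg (by linarith) (by linarith))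
  have h5 := Real.one_sub_inv_le_log_of_pos (by linarith : 0 < r)
  have h6 : 1 - r⁻¹ = (r - 1) * r⁻¹ := by
    have : r ≠ 0 := by linarith
    field_simp
  have h7 : ellipseForm t r z - T * r⁻¹ ≤ -(η / 2) := by linarith
  have h8 := mul_le_mul_of_nonneg_left h7 (by linarith : 0 ≤ r - 1)
  have h9 := mul_le_mul_of_nonneg_left h5 hT.le
  rw [h6] at h9
  linarith

theorem exists_rate_exterior {t η : ℝ} (T : ℝ) (ht : 0 ≤ t) (ht1 : t < 1) (hT : 0 < T)
    (hη : 0 < η) : ∃ r : ℝ, 0 < r ∧ r < 1 ∧ ∃ ε : ℝ, 0 < ε ∧ ∀ z : ℂ,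
      T + η ≤ ellipseForm t 1 z → (r - 1) * ellipseForm t r z - T * Real.log r ≤ -ε := by
  have hp : 1 - t ≠ 0 := by linarith
  have hcont : ContinuousAt (fun r : ℝ => T * r⁻¹ - (1 - t) / (1 - t * r) * (T + η)) 1 := by
    have : 1 - t * 1 ≠ 0 := by simpa using hp
    fun_prop (disch := first | assumption | norm_num)
  have hval : T * (1 : ℝ)⁻¹ - (1 - t) / (1 - t * 1) * (T + η) < -(η / 2) := by
    rw [mul_one t, div_self hp]
    linarith
  have h1 := hcont.eventually_lt continuousAt_const hval
  have h2 : ∀ᶠ r : ℝ in 𝓝 1, 0 < r := eventually_gt_nhds one_pos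
  obtain ⟨r, ⟨hr1, hr2⟩, hr3⟩ :=
    (((h1.and h2).filter_mono nhdsWithin_le_nhds).and
      (self_mem_nhdsWithin : Set.Iio (1 : ℝ) ∈ 𝓝[<] 1)).exists
  have hr3 : r < 1 := hr3
  refine ⟨r, hr2, hr3, (1 - r) * (η / 2), mul_pos (by linarith) (by linarith), fun z hz => ?_⟩
  have h3 := le_ellipseForm ht ht1 hr2 hr3.le z
  have h4 : (1 - t) / (1 - t * r) * (T + η) ≤ (1 - t) / (1 - t * r) * ellipseForm t 1 z :=
    mul_le_mul_of_nonneg_left hz (div_nonneg (by linarith) (by nlinarith))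
  have h5 := Real.one_sub_inv_le_log_of_pos hr2
  have h6 : 1 - r⁻¹ = (r - 1) * r⁻¹ := by
    field_simp
  have h7 : T * r⁻¹ - ellipseForm t r z ≤ -(η / 2) := by linarith
  have h8 := mul_le_mul_of_nonneg_left h7 (by linarith : 0 ≤ 1 - r)
  have h9 := mul_le_mul_of_nonneg_left h5 hT.le
  rw [h6] at h9
  linarith

/-! ### Exponential bounds for partial sums and tails -/

/-- The constant prefactor of the weighted sums. -/
noncomputable def massFactor (t r : ℝ) : ℝ := √(1 - t ^ 2) / (Real.pi * √(1 - t ^ 2 * r ^ 2))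

theorem massFactor_nonneg (t r : ℝ) : 0 ≤ massFactor t r := by
  unfold massFactor
  positivity

theorem sum_norm_sq_waveFunction_le {t N : ℝ} (ht : 0 ≤ t) (ht1 : t < 1) (hN : 0 < N)
    (F : Finset ℕ) (z : ℂ) : ∑ j ∈ F, ‖waveFunction t N j z‖ ^ 2 ≤ 1 / Real.pi := by
  have h := hasSum_pow_mul_norm_sq_waveFunction ht ht1 hN zero_le_one (by linarith) z
  have h0 := one_sub_sq_pos ht ht1
  have e1 : √(1 - t ^ 2) / (Real.pi * √(1 - t ^ 2)) = 1 / Real.pi := by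
    have : √(1 - t ^ 2) ≠ 0 := by positivity
    field_simp
  simp only [one_pow, one_mul, mul_one, sub_self, zero_mul, mul_zero, Real.exp_zero, e1] at h
  exact sum_le_hasSum F (fun j _ => by positivity) h

/-- Chernoff's bound: insert `r ^ (j - n) ≥ 1` and extend the sum to all indices. The hypothesis on
`F` covers both tails with `r > 1` and heads with `r < 1`. -/
theorem sum_norm_sq_waveFunction_le_exp {t T N r ε : ℝ} (ht : 0 ≤ t) (ht1 : t < 1) (hN : 0 < N)
    (hr : 0 < r) (hrt : t * r < 1) {n : ℕ} (hn : (n : ℝ) = N * T) {F : Finset ℕ}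
    (hF : ∀ j ∈ F, r ^ n ≤ r ^ j) {z : ℂ}
    (hz : (r - 1) * ellipseForm t r z - T * Real.log r ≤ -ε) :
    ∑ j ∈ F, ‖waveFunction t N j z‖ ^ 2 ≤ massFactor t r * Real.exp (-(N * ε)) := by
  have h := hasSum_pow_mul_norm_sq_waveFunction ht ht1 hN hr.le hrt z
  have h1 := sum_le_hasSum F (fun j _ => by positivity) h
  have h2 : r ^ n * ∑ j ∈ F, ‖waveFunction t N j z‖ ^ 2 ≤
      ∑ j ∈ F, r ^ j * ‖waveFunction t N j z‖ ^ 2 := by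
    rw [Finset.mul_sum]
    exact Finset.sum_le_sum fun j hj => mul_le_mul_of_nonneg_right (hF j hj) (sq_nonneg _)
  have h3 : r ^ n = Real.exp (N * (T * Real.log r)) := by
    rw [← mul_assoc, ← hn, Real.exp_nat_mul, Real.exp_log hr]
  have h4 := h2.trans h1
  rw [h3] at h4
  have h5 : Real.exp (N * ((r - 1) * ellipseForm t r z)) ≤
      Real.exp (N * (T * Real.log r)) * Real.exp (-(N * ε)) := by
    rw [← Real.exp_add]
    apply Real.exp_le_exp.2
    nlinarith [mul_le_mul_of_nonneg_left hz hN.le]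
  have h6 := mul_le_mul_of_nonneg_left h5 (massFactor_nonneg t r)
  refine le_of_mul_le_mul_left (h4.trans (h6.trans_eq ?_)) (Real.exp_pos (N * (T * Real.log r)))
  ring

/-- Cauchy–Schwarz as an AM–GM inequality weighted by `s`. Smallness `s ^ 2` of one diagonal sum
gives only `s`, which is why rates are halved off the diagonal. -/
theorem sum_norm_mul_norm_le {ι : Type*} {F : Finset ι} {a b : ι → ℂ} {C s : ℝ} (hs : 0 < s)
    (ha : ∑ j ∈ F, ‖a j‖ ^ 2 ≤ C) (hb : ∑ j ∈ F, ‖b j‖ ^ 2 ≤ C * s ^ 2) :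
    ∑ j ∈ F, ‖a j‖ * ‖b j‖ ≤ C * s := by
  have h1 : ∀ j, ‖a j‖ * ‖b j‖ ≤ s / 2 * ‖a j‖ ^ 2 + 1 / (2 * s) * ‖b j‖ ^ 2 := fun j => by
    have : s / 2 * ‖a j‖ ^ 2 + 1 / (2 * s) * ‖b j‖ ^ 2 - ‖a j‖ * ‖b j‖ =
        1 / (2 * s) * (s * ‖a j‖ - ‖b j‖) ^ 2 := by
      field_simp
      ring
    have h2 : 0 ≤ 1 / (2 * s) * (s * ‖a j‖ - ‖b j‖) ^ 2 := by positivity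
    linarith
  calc _ ≤ ∑ j ∈ F, (s / 2 * ‖a j‖ ^ 2 + 1 / (2 * s) * ‖b j‖ ^ 2) :=
        Finset.sum_le_sum fun j _ => h1 j
    _ = s / 2 * ∑ j ∈ F, ‖a j‖ ^ 2 + 1 / (2 * s) * ∑ j ∈ F, ‖b j‖ ^ 2 := by
        rw [Finset.sum_add_distrib, Finset.mul_sum, Finset.mul_sum]
    _ ≤ s / 2 * C + 1 / (2 * s) * (C * s ^ 2) := by gcongr
    _ = C * s := by
        field_simp
        ring

/-- Exponential smallness of off-diagonal sums over index sets on which the diagonal sum is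
exponentially small at one of the two points. -/
theorem norm_sum_waveFunction_le {t T N r ε : ℝ} (ht : 0 ≤ t) (ht1 : t < 1) (hN : 0 < N)
    (hr : 0 < r) (hrt : t * r < 1) {n : ℕ} (hn : (n : ℝ) = N * T) {F : Finset ℕ}
    (hF : ∀ j ∈ F, r ^ n ≤ r ^ j) {z w : ℂ}
    (hzw : (r - 1) * ellipseForm t r z - T * Real.log r ≤ -ε ∨
      (r - 1) * ellipseForm t r w - T * Real.log r ≤ -ε) :
    ‖∑ j ∈ F, waveFunction t N j z * conj (waveFunction t N j w)‖ ≤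
      (1 / Real.pi + massFactor t r) * Real.exp (-(N * (ε / 2))) := by
  have hM := massFactor_nonneg t r
  have hsq : Real.exp (-(N * (ε / 2))) ^ 2 = Real.exp (-(N * ε)) := by
    rw [← Real.exp_nat_mul]
    congr 1
    push_cast
    ring
  have hbig : ∀ x : ℂ, ∑ j ∈ F, ‖waveFunction t N j x‖ ^ 2 ≤ 1 / Real.pi + massFactor t r :=
    fun x => (sum_norm_sq_waveFunction_le ht ht1 hN F x).trans (by linarith)
  have hsmall : ∀ x : ℂ, (r - 1) * ellipseForm t r x - T * Real.log r ≤ -ε →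
      ∑ j ∈ F, ‖waveFunction t N j x‖ ^ 2 ≤
        (1 / Real.pi + massFactor t r) * Real.exp (-(N * (ε / 2))) ^ 2 := fun x hx => by
    rw [hsq]
    refine (sum_norm_sq_waveFunction_le_exp ht ht1 hN hr hrt hn hF hx).trans ?_
    gcongr
    have := Real.pi_pos
    linarith [one_div_pos.2 this]
  refine (norm_sum_le _ _).trans ?_
  simp_rw [norm_mul, RCLike.norm_conj]
  rcases hzw with h | h
  · simp_rw [mul_comm ‖waveFunction t N _ z‖]
    exact sum_norm_mul_norm_le (Real.exp_pos _) (hbig w) (hsmall z h)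
  · exact sum_norm_mul_norm_le (Real.exp_pos _) (hbig z) (hsmall w h)

/-- The limiting kernel: the reproducing kernel of the full weighted Fock space, divided
by `N`. -/
noncomputable def bulkKernel (t N : ℝ) (z w : ℂ) : ℂ :=
  (1 / (Real.pi : ℂ)) * ((Real.exp (-(N / 2) * ‖z - w‖ ^ 2) : ℝ) : ℂ) *
    Complex.exp (Complex.I * (N : ℂ) * (((z * conj w - (t : ℂ) / 2 * z ^ 2 -
      (t : ℂ) / 2 * (conj w) ^ 2).im : ℝ) : ℂ))

theorem norm_bulkKernel (t N : ℝ) (z w : ℂ) :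
    ‖bulkKernel t N z w‖ = 1 / Real.pi * Real.exp (-(N / 2) * ‖z - w‖ ^ 2) := by
  have h : ∀ x : ℝ, ‖Complex.exp (Complex.I * N * x)‖ = 1 := fun x => by
    have e : Complex.I * N * x = ((N * x : ℝ) : ℂ) * Complex.I := by push_cast; ring
    rw [e, Complex.norm_exp_ofReal_mul_I]
  rw [bulkKernel, norm_mul, norm_mul, h, mul_one, Complex.norm_of_nonneg (Real.exp_pos _).le,
    norm_div, norm_one, Complex.norm_of_nonneg Real.pi_pos.le]

theorem norm_sum_sub_bulkKernel_le {t T N r ε : ℝ} (ht : 0 ≤ t) (ht1 : t < 1) (hN : 0 < N)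
    (hr : 1 < r) (hrt : t * r < 1) {n : ℕ} (hn : (n : ℝ) = N * T) {z w : ℂ}
    (hzw : (r - 1) * ellipseForm t r z - T * Real.log r ≤ -ε ∨
      (r - 1) * ellipseForm t r w - T * Real.log r ≤ -ε) :
    ‖(∑ j ∈ Finset.range n, waveFunction t N j z * conj (waveFunction t N j w)) -
      bulkKernel t N z w‖ ≤ (1 / Real.pi + massFactor t r) * Real.exp (-(N * (ε / 2))) := by
  have h := (hasSum_nat_add_iff' n).2 (hasSum_waveFunction ht ht1 hN z w)
  rw [norm_sub_rev]
  refine le_of_tendsto' h.norm fun F => ?_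
  -- The difference is a limit of finite sums over indices shifted by `n`, all bounded uniformly.
  have := norm_sum_waveFunction_le ht ht1 hN (by linarith : 0 < r) hrt hn
    (F := F.map (addRightEmbedding n)) (fun j hj => ?_) hzw
  · simpa using this
  · obtain ⟨i, _, rfl⟩ := Finset.mem_map.1 hj
    exact pow_le_pow_right₀ hr.le (by simp)

end NormalMatrix

/-! ### Assembly of the asymptotics -/

open NormalMatrix

theorem theorem3 (t T : ℝ) (ht0 : 0 ≤ t) (ht1 : t < 1) (hT : 0 < T)
    (VK UK : Set ℂ) (hVK : IsCompact VK)
    (hVK_sub : VK ⊆ interior (NormalMatrix.droplet t T))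
    (hUK : UK ∈ 𝓝ˢ (NormalMatrix.droplet t T)) :
    (∀ N : ℝ, 0 < N → ∃ p : ℕ → Polynomial ℂ, NormalMatrix.IsOrthonormalPolynomials t N p) ∧
    ∃ ε : ℝ, 0 < ε ∧ ∃ δ : ℝ, 0 < δ ∧ ∃ C : ℝ, 0 < C ∧ ∃ N₀ : ℝ, 0 < N₀ ∧
      ∀ (N : ℝ) (n : ℕ), N₀ ≤ N → (n : ℝ) = N * T →
      ∀ p : ℕ → Polynomial ℂ, NormalMatrix.IsOrthonormalPolynomials t N p →
      ∀ z w : ℂ,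
        ((w ∈ VK ∧ z ∈ Metric.ball w δ) ∨ (z ∈ VK ∧ w ∈ Metric.ball z δ) →
          ∃ r : ℂ, ‖r‖ ≤ C * Real.exp (-(N * ε)) ∧
            (1 / (N : ℂ)) * NormalMatrix.corrKernel t N p n z w =
              (1 / (Real.pi : ℂ)) *
                ((Real.exp (-(N / 2) * ‖z - w‖ ^ 2) : ℝ) : ℂ) *
                Complex.exp (Complex.I * (N : ℂ) *
                  (((z * conj w - (t : ℂ) / 2 * z ^ 2 -
                    (t : ℂ) / 2 * (conj w) ^ 2).im : ℝ) : ℂ)) *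
                (1 + r)) ∧
        ((w ∈ VK ∧ z ∉ Metric.ball w δ) ∨ (z ∈ VK ∧ w ∉ Metric.ball z δ) →
          ‖(1 / (N : ℂ)) * NormalMatrix.corrKernel t N p n z w‖ ≤
            C * Real.exp (-(N * ε))) ∧
        (w ∉ UK ∨ z ∉ UK →
          ‖(1 / (N : ℂ)) * NormalMatrix.corrKernel t N p n z w‖ ≤
            C * Real.exp (-(N * ε))) := by
  refine ⟨fun N hN => ⟨_, isOrthonormalPolynomials_orthonormalHermite ht0 ht1 hN⟩, ?_⟩
  obtain ⟨η, hη, hVη⟩ := exists_ellipseForm_le_of_isCompact hT hVK hVK_sub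
  obtain ⟨r, hr, hrt, ε₀, hε₀, hin⟩ := exists_rate_interior T ht0 ht1 hT hη
  obtain ⟨η', hη', hUη⟩ := exists_le_ellipseForm_of_mem_nhdsSet ht0 ht1 hUK
  obtain ⟨r', hr', hr1', ε₁, hε₁, hout⟩ := exists_rate_exterior T ht0 ht1 hT hη'
  set A : ℝ := 1 / Real.pi + massFactor t r with hA
  set B : ℝ := 1 / Real.pi + massFactor t r' with hB
  have hpi := Real.pi_pos
  have hA0 : 0 < A := add_pos_of_pos_of_nonneg (one_div_pos.2 hpi) (massFactor_nonneg t r)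
  have hB0 : 0 < B := add_pos_of_pos_of_nonneg (one_div_pos.2 hpi) (massFactor_nonneg t r')
  have hpi1 : 0 < 1 / Real.pi := one_div_pos.2 hpi
  have hpiA : 0 < Real.pi * A := mul_pos hpi hA0
  have hδ2 : √(ε₀ / 2) ^ 2 = ε₀ / 2 := Real.sq_sqrt (by linarith)
  -- The bulk error is of order `exp(-N ε₀/2)`. With `δ² = ε₀/2` the main term is at least `exp(-N
  -- ε₀/4)/π` within `δ`, giving relative error of order `exp(-N ε₀/4)`, and at most that size
  -- beyond `δ`. The exterior rate is `ε₁/2`. The constant adds those of the three cases, and `N₀ =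
  -- 1` serves only to make `N` positive.
  refine ⟨min (ε₀ / 4) (ε₁ / 2), lt_min (by linarith) (by linarith), √(ε₀ / 2),
    Real.sqrt_pos.2 (by linarith), Real.pi * A + (1 / Real.pi + A) + B, by positivity,
    1, one_pos, fun N n hN hn p hp z w => ?_⟩
  have hN0 : 0 < N := by linarith
  rw [corrKernel_eq_sum_waveFunction ht0 ht1 hN0 hp]
  set ε : ℝ := min (ε₀ / 4) (ε₁ / 2) with hε
  have hexp0 : Real.exp (-(N * (ε₀ / 4))) ≤ Real.exp (-(N * ε)) :=
    Real.exp_le_exp.2 (neg_le_neg (mul_le_mul_of_nonneg_left (min_le_left _ _) hN0.le))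
  have hexp1 : Real.exp (-(N * (ε₁ / 2))) ≤ Real.exp (-(N * ε)) :=
    Real.exp_le_exp.2 (neg_le_neg (mul_le_mul_of_nonneg_left (min_le_right _ _) hN0.le))
  have hexp2 : Real.exp (-(N * (ε₀ / 2))) ≤ Real.exp (-(N * (ε₀ / 4))) :=
    Real.exp_le_exp.2 (neg_le_neg (mul_le_mul_of_nonneg_left (by linarith) hN0.le))
  have hE := Real.exp_pos (-(N * ε))
  have hbulk : w ∈ VK ∨ z ∈ VK → ‖(∑ j ∈ Finset.range n,
      waveFunction t N j z * conj (waveFunction t N j w)) - bulkKernel t N z w‖ ≤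
      A * Real.exp (-(N * (ε₀ / 2))) := fun h =>
    norm_sum_sub_bulkKernel_le ht0 ht1 hN0 hr hrt hn
      -- Smallness at either point suffices, which yields the statement with `z` and `w` exchanged
      -- at no extra cost.
      (h.symm.imp (fun h => hin z (hVη z h)) (fun h => hin w (hVη w h)))
  refine ⟨fun h => ?_, fun h => ?_, fun h => ?_⟩
  · have hdist : ‖z - w‖ < √(ε₀ / 2) := by
      rcases h with h | h
      · exact mem_ball_iff_norm.1 h.2
      · rw [norm_sub_rev]
        exact mem_ball_iff_norm.1 h.2
    have hsq : ‖z - w‖ ^ 2 ≤ ε₀ / 2 := by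
      rw [← hδ2]
      gcongr
    have hb := hbulk (h.imp And.left And.left)
    have hlow : 1 / Real.pi * Real.exp (-(N * (ε₀ / 4))) ≤ ‖bulkKernel t N z w‖ := by
      rw [norm_bulkKernel]
      gcongr
      nlinarith
    have hpos : 0 < ‖bulkKernel t N z w‖ := lt_of_lt_of_le (by positivity) hlow
    have hne : bulkKernel t N z w ≠ 0 := norm_pos_iff.1 hpos
    refine ⟨((∑ j ∈ Finset.range n, waveFunction t N j z * conj (waveFunction t N j w)) -
      bulkKernel t N z w) / bulkKernel t N z w, ?_, ?_⟩
    · rw [norm_div, div_le_iff₀ hpos]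
      -- Half of the decay is spent on the lower bound for the main term; the other half is the
      -- relative error.
      have h1 : A * Real.exp (-(N * (ε₀ / 2))) =
          Real.pi * A * Real.exp (-(N * (ε₀ / 4))) *
            (1 / Real.pi * Real.exp (-(N * (ε₀ / 4)))) := by
        have : Real.exp (-(N * (ε₀ / 2))) =
            Real.exp (-(N * (ε₀ / 4))) * Real.exp (-(N * (ε₀ / 4))) := by
          rw [← Real.exp_add]
          congr 1
          ring
        rw [this]
        field_simp
      rw [h1] at hb
      refine hb.trans ?_
      gcongr
      linarith
    · change _ = bulkKernel t N z w * _
      field_simp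
      ring
  · have hdist : √(ε₀ / 2) ≤ ‖z - w‖ := by
      rcases h with h | h
      · exact not_lt.1 fun h' => h.2 (mem_ball_iff_norm.2 h')
      · rw [norm_sub_rev]
        exact not_lt.1 fun h' => h.2 (mem_ball_iff_norm.2 h')
    have hsq : ε₀ / 2 ≤ ‖z - w‖ ^ 2 := by
      rw [← hδ2]
      gcongr
    have hb := hbulk (h.imp And.left And.left)
    have hup : ‖bulkKernel t N z w‖ ≤ 1 / Real.pi * Real.exp (-(N * (ε₀ / 4))) := by
      rw [norm_bulkKernel]
      gcongr
      nlinarith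
    have h1 := norm_le_norm_add_norm_sub' (∑ j ∈ Finset.range n,
      waveFunction t N j z * conj (waveFunction t N j w)) (bulkKernel t N z w)
    have h2 : 1 / Real.pi * Real.exp (-(N * (ε₀ / 4))) ≤ 1 / Real.pi * Real.exp (-(N * ε)) := by
      gcongr
    have h3 : A * Real.exp (-(N * (ε₀ / 2))) ≤ A * Real.exp (-(N * ε)) :=
      mul_le_mul_of_nonneg_left (hexp2.trans hexp0) hA0.le
    nlinarith [mul_pos hpiA hE, mul_pos hB0 hE]
  · have h1 := norm_sum_waveFunction_le ht0 ht1 hN0 hr' (by nlinarith : t * r' < 1) hn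
      (F := Finset.range n)
      (fun j hj => pow_le_pow_of_le_one hr'.le hr1'.le (Finset.mem_range.1 hj).le)
      (h.symm.imp (fun h => hout z (hUη z h)) (fun h => hout w (hUη w h)))
    refine h1.trans ?_
    have h2 : B * Real.exp (-(N * (ε₁ / 2))) ≤ B * Real.exp (-(N * ε)) :=
      mul_le_mul_of_nonneg_left hexp1 hB0.le
    refine h2.trans ?_
    gcongr
    linarith
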